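/- Let $\Gamma=\mathbb Z_4=\langle g\mid g^4=1\rangle$ with generating set $S=\{g,g^{-1}\}$ and word length $l$. Let $D(\delta_h)=l(h)\delta_h$ be the Dirac operator of the spectral triple $\widehat{\mathbb Z_4}=(C^*(\Gamma),\ell^2(\Gamma),D)$. The quantum isometry group $G^+(\widehat{\mathbb Z_4})$ is the universal compact quantum group acting on $C^*(\Gamma)$ such that all eigenspaces of $D$ and the standard trace $tr(h)=\delta_{h,1}$ on $\mathbb C\Gamma$ are invariant; $C(G)$ denotes the full $C^*$-algebra of a compact quantum group $G$, i.e. the universal $C^*$-completion of the Hopf $*$-algebra spanned by the coefficients of its finite-dimensional unitary corepresentations. **Proposition 6.3.** The quantum group $G^+(\widehat{\mathbb Z_4})$ exists, and there is a $*$-algebra isomorphism $$C(G^+(\widehat{\mathbb Z_4}))\simeq C^*(D_\infty\times\mathbb Z_2),$$ where the right-hand side is the full group $C^*$-algebra. More precisely, the universal action $\alpha$ has the form $$\alpha(g)=g\otimes A+g^{-1}\otimes B^*,\qquad \alpha(g^{-1})=g\otimes B+g^{-1}\otimes A^* ,$$ i.e. the fundamental corepresentation is $u=\begin{pmatrix}A&B\\B^*&A^*\end{pmatrix}$.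 Write $D_\infty=\langle s_0,s_1\mid s_0^2=s_1^2=1\rangle$, let $z$ be the generator of $\mathbb Z_2$, identify group elements with the corresponding unitaries of $C^*(D_\infty\times\mathbb Z_2)$, and put $w=\tfrac{1+z}{2}-i\,\tfrac{1-z}{2}$. Then there is a $*$-isomorphism $\Phi:C(G^+(\widehat{\mathbb Z_4}))\to C^*(D_\infty\times\mathbb Z_2)$ with $$\Phi(A^2+B^2)=z,\qquad \Phi(A+B)=w\,s_0,\qquad \Phi(A-B)=w\,s_1 .$$ In particular $T=A^2+B^2$ is a central self-adjoint unitary, and on the summands $T=1$ and $T=-1$ the elements $A\pm B$, respectively $i(A\pm B)$, correspond to the two canonical generators of $C^*(D_\infty)$. -/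

import Mathlib

open scoped TensorProduct

/-! ### The group algebra as a `*`-algebra -/

section GroupAlgebra

variable {Γ : Type*} [Group Γ]

/-- The involution of `ℂΓ`: antilinear, with `g* = g⁻¹`. -/
noncomputable instance groupAlgebraStar : Star (MonoidAlgebra ℂ Γ) where
  star f := MonoidAlgebra.ofCoeff
    ((f.coeff.mapRange (star : ℂ → ℂ) (star_zero ℂ)).equivMapDomain (Equiv.inv Γ))

theorem groupAlgebra_coeff_star (f : MonoidAlgebra ℂ Γ) (g : Γ) :
    (star f).coeff g = star (f.coeff g⁻¹) := by
  simp [star, Finsupp.equivMapDomain_apply]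

theorem groupAlgebra_star_single (g : Γ) (c : ℂ) :
    star (MonoidAlgebra.single g c) = MonoidAlgebra.single g⁻¹ (star c) := by
  classical
  ext h
  rw [groupAlgebra_coeff_star]
  simp only [MonoidAlgebra.coeff_single, Finsupp.single_apply, eq_comm (a := g), inv_eq_iff_eq_inv,
    eq_comm (a := g⁻¹)]
  split_ifs <;> simp

theorem groupAlgebra_star_add (x y : MonoidAlgebra ℂ Γ) : star (x + y) = star x + star y := by
  ext h
  simp [groupAlgebra_coeff_star]

noncomputable instance groupAlgebraStarRing : StarRing (MonoidAlgebra ℂ Γ) where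
  star_involutive x := by
    ext h
    simp [groupAlgebra_coeff_star]
  star_add := groupAlgebra_star_add
  star_mul x y := by
    induction x using MonoidAlgebra.induction_linear with
    | zero =>
      have h0 : star (0 : MonoidAlgebra ℂ Γ) = 0 := by ext h; simp [groupAlgebra_coeff_star]
      simp [h0]
    | add x x' hx hx' => rw [add_mul, groupAlgebra_star_add, hx, hx', groupAlgebra_star_add, mul_add]
    | single g c =>
      induction y using MonoidAlgebra.induction_linear with
      | zero =>
        have h0 : star (0 : MonoidAlgebra ℂ Γ) = 0 := by ext h; simp [groupAlgebra_coeff_star]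
        simp [h0]
      | add y y' hy hy' =>
        rw [mul_add, groupAlgebra_star_add, hy, hy', groupAlgebra_star_add, add_mul]
      | single h d =>
        simp [groupAlgebra_star_single, MonoidAlgebra.single_mul_single, mul_comm]

instance groupAlgebraStarModule : StarModule ℂ (MonoidAlgebra ℂ Γ) where
  star_smul c x := by
    ext h
    simp [groupAlgebra_coeff_star]

end GroupAlgebra

/-! ### The universal (maximal) C⋆-completion of a `*`-algebra -/

section MaxCStar

universe u

/-- The values `‖π(x)‖`, where `π` runs over the unital `*`-homomorphisms from `P` to
unital C⋆-algebras. -/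
def cstarValues (P : Type u) [Ring P] [StarRing P] [Algebra ℂ P] (x : P) : Set ℝ :=
  {r | ∃ (D : Type u) (_ : CStarAlgebra D) (π : P →⋆ₐ[ℂ] D), ‖π x‖ = r}

/-- `P` has a universal C⋆-completion: every element is bounded uniformly over all
`*`-homomorphisms to C⋆-algebras. -/
class HasMaxCStarNorm (P : Type u) [Ring P] [StarRing P] [Algebra ℂ P] : Prop where
  bddAbove : ∀ x : P, BddAbove (cstarValues P x)

/-- The maximal C⋆-seminorm `x ↦ sup_π ‖π(x)‖`. -/
noncomputable def maxCStarNorm (P : Type u) [Ring P] [StarRing P] [Algebra ℂ P] (x : P) : ℝ :=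
  sSup (cstarValues P x)

section

variable {P : Type u} [Ring P] [StarRing P] [Algebra ℂ P]

theorem maxCStarNorm_nonneg (x : P) : 0 ≤ maxCStarNorm P x :=
  Real.sSup_nonneg (by rintro _ ⟨D, _, π, rfl⟩; exact norm_nonneg _)

theorem le_maxCStarNorm [HasMaxCStarNorm P] {D : Type u} [CStarAlgebra D] (π : P →⋆ₐ[ℂ] D)
    (x : P) : ‖π x‖ ≤ maxCStarNorm P x :=
  le_csSup (HasMaxCStarNorm.bddAbove x) ⟨D, _, π, rfl⟩

theorem maxCStarNorm_le {x : P} {C : ℝ} (hC : 0 ≤ C)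
    (h : ∀ (D : Type u) [CStarAlgebra D] (π : P →⋆ₐ[ℂ] D), ‖π x‖ ≤ C) : maxCStarNorm P x ≤ C :=
  Real.sSup_le (by rintro _ ⟨D, _, π, rfl⟩; exact h D π) hC

theorem maxCStarNorm_add_le [HasMaxCStarNorm P] (x y : P) :
    maxCStarNorm P (x + y) ≤ maxCStarNorm P x + maxCStarNorm P y :=
  maxCStarNorm_le (add_nonneg (maxCStarNorm_nonneg x) (maxCStarNorm_nonneg y)) fun D _ π => by
    rw [map_add]
    exact (norm_add_le _ _).trans (add_le_add (le_maxCStarNorm π x) (le_maxCStarNorm π y))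

theorem maxCStarNorm_zero : maxCStarNorm P 0 = 0 :=
  le_antisymm (maxCStarNorm_le le_rfl fun D _ π => by simp) (maxCStarNorm_nonneg _)

theorem maxCStarNorm_neg (x : P) : maxCStarNorm P (-x) = maxCStarNorm P x := by
  have h : cstarValues P (-x) = cstarValues P x := by simp [cstarValues]
  unfold maxCStarNorm
  rw [h]

theorem maxCStarNorm_star (x : P) : maxCStarNorm P (star x) = maxCStarNorm P x := by
  have h : cstarValues P (star x) = cstarValues P x := by simp [cstarValues, map_star]
  unfold maxCStarNorm
  rw [h]

theorem maxCStarNorm_mul_le [HasMaxCStarNorm P] (x y : P) :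
    maxCStarNorm P (x * y) ≤ maxCStarNorm P x * maxCStarNorm P y :=
  maxCStarNorm_le (mul_nonneg (maxCStarNorm_nonneg x) (maxCStarNorm_nonneg y)) fun D _ π => by
    rw [map_mul]
    exact (norm_mul_le _ _).trans (mul_le_mul (le_maxCStarNorm π x) (le_maxCStarNorm π y)
      (norm_nonneg _) (maxCStarNorm_nonneg x))

theorem maxCStarNorm_smul_le [HasMaxCStarNorm P] (c : ℂ) (x : P) :
    maxCStarNorm P (c • x) ≤ ‖c‖ * maxCStarNorm P x :=
  maxCStarNorm_le (mul_nonneg (norm_nonneg c) (maxCStarNorm_nonneg x)) fun D _ π => by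
    rw [map_smul]
    exact (norm_smul_le _ _).trans
      (mul_le_mul_of_nonneg_left (le_maxCStarNorm π x) (norm_nonneg c))

theorem maxCStarNorm_mul_self_le [HasMaxCStarNorm P] (x : P) :
    maxCStarNorm P x * maxCStarNorm P x ≤ maxCStarNorm P (star x * x) := by
  have h0 := maxCStarNorm_nonneg (star x * x)
  have h : maxCStarNorm P x ≤ √(maxCStarNorm P (star x * x)) :=
    maxCStarNorm_le (Real.sqrt_nonneg _) fun D _ π => by
      refine Real.le_sqrt_of_sq_le ?_
      rw [sq, ← CStarRing.norm_star_mul_self, ← map_star, ← map_mul]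
      exact le_maxCStarNorm π _
  calc _ ≤ √(maxCStarNorm P (star x * x)) * √(maxCStarNorm P (star x * x)) :=
        mul_le_mul h h (maxCStarNorm_nonneg x) (Real.sqrt_nonneg _)
    _ = _ := Real.mul_self_sqrt h0

end

/-- A copy of `P`, carrying the maximal C⋆-seminorm. -/
def PreMaxCStar (P : Type u) : Type u := P

section

variable (P : Type u) [Ring P] [StarRing P] [Algebra ℂ P] [HasMaxCStarNorm P]

noncomputable instance : Ring (PreMaxCStar P) := inferInstanceAs (Ring P)

noncomputable instance : StarRing (PreMaxCStar P) := inferInstanceAs (StarRing P)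

noncomputable instance preMaxCStarAlgebra : Algebra ℂ (PreMaxCStar P) :=
  inferInstanceAs (Algebra ℂ P)

instance [StarModule ℂ P] : StarModule ℂ (PreMaxCStar P) := inferInstanceAs (StarModule ℂ P)

/-- The identity map from `P` to its copy. -/
def toPreMaxCStar : P →⋆ₐ[ℂ] PreMaxCStar P := StarAlgHom.id ℂ P

noncomputable instance : SeminormedRing (PreMaxCStar P) where
  __ := (inferInstance : Ring (PreMaxCStar P))
  __ := AddGroupSeminorm.toSeminormedAddCommGroup
    ({ toFun := maxCStarNorm P
       map_zero' := maxCStarNorm_zero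
       add_le' := maxCStarNorm_add_le (P := P)
       neg' := maxCStarNorm_neg (P := P) } : AddGroupSeminorm (PreMaxCStar P))
  norm_mul_le := maxCStarNorm_mul_le (P := P)

noncomputable instance : NormedAlgebra ℂ (PreMaxCStar P) where
  __ := preMaxCStarAlgebra P
  norm_smul_le := maxCStarNorm_smul_le (P := P)

theorem preMaxCStar_norm_mul_self_le (x : PreMaxCStar P) : ‖x‖ * ‖x‖ ≤ ‖star x * x‖ :=
  maxCStarNorm_mul_self_le (P := P) x

instance : NormedStarGroup (PreMaxCStar P) where
  norm_star_le x := (maxCStarNorm_star (P := P) x).le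

/-- The universal C⋆-algebra of `P`: the (Hausdorff) completion of `P` for the maximal
C⋆-seminorm. -/
def MaxCStar : Type u := UniformSpace.Completion (PreMaxCStar P)

namespace MaxCStar

noncomputable instance : NormedRing (MaxCStar P) :=
  inferInstanceAs (NormedRing (UniformSpace.Completion (PreMaxCStar P)))

instance : CompleteSpace (MaxCStar P) :=
  inferInstanceAs (CompleteSpace (UniformSpace.Completion (PreMaxCStar P)))

noncomputable instance instAlgebra : Algebra ℂ (MaxCStar P) :=
  inferInstanceAs (Algebra ℂ (UniformSpace.Completion (PreMaxCStar P)))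

noncomputable instance : NormedAlgebra ℂ (MaxCStar P) where
  __ := instAlgebra P
  norm_smul_le := norm_smul_le (α := ℂ) (β := UniformSpace.Completion (PreMaxCStar P))

/-- The canonical map from `P` to its universal C⋆-algebra, before it is known to be a
`*`-homomorphism. -/
noncomputable def coeFun (x : PreMaxCStar P) : MaxCStar P :=
  UniformSpace.Completion.coe' x

variable {P}

theorem continuous_coeFun : Continuous (coeFun P) := UniformSpace.Completion.continuous_coe _

theorem coeFun_add (x y : PreMaxCStar P) : coeFun P (x + y) = coeFun P x + coeFun P y :=
  UniformSpace.Completion.coe_add x y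

theorem coeFun_mul (x y : PreMaxCStar P) : coeFun P (x * y) = coeFun P x * coeFun P y :=
  UniformSpace.Completion.coe_mul x y

theorem coeFun_smul (c : ℂ) (x : PreMaxCStar P) : coeFun P (c • x) = c • coeFun P x :=
  UniformSpace.Completion.coe_smul c x

theorem norm_coeFun (x : PreMaxCStar P) : ‖coeFun P x‖ = ‖x‖ :=
  UniformSpace.Completion.norm_coe x

theorem denseRange_coeFun : DenseRange (coeFun P) := UniformSpace.Completion.denseRange_coe

/-- The involution, extended by continuity. -/
noncomputable instance : Star (MaxCStar P) where
  star := UniformSpace.Completion.map (star : PreMaxCStar P → PreMaxCStar P)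

theorem continuous_star' : Continuous (star : MaxCStar P → MaxCStar P) :=
  UniformSpace.Completion.continuous_map

theorem star_coeFun (x : PreMaxCStar P) : star (coeFun P x) = coeFun P (star x) :=
  UniformSpace.Completion.map_coe
    (starNormedAddGroupHom (E := PreMaxCStar P)).uniformContinuous x

noncomputable instance : StarRing (MaxCStar P) where
  star_involutive x := denseRange_coeFun.induction_on (p := fun x => star (star x) = x) x
    (isClosed_eq (continuous_star'.comp continuous_star') continuous_id)
    fun a => by rw [star_coeFun, star_coeFun, star_star]
  star_add x y := denseRange_coeFun.induction_on₂
    (p := fun x y : MaxCStar P => star (x + y) = star x + star y)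
    (isClosed_eq (continuous_star'.comp (continuous_fst.add continuous_snd))
      ((continuous_star'.comp continuous_fst).add (continuous_star'.comp continuous_snd)))
    (fun a b => by simp only [← coeFun_add, star_coeFun, star_add]) x y
  star_mul x y := denseRange_coeFun.induction_on₂
    (p := fun x y : MaxCStar P => star (x * y) = star y * star x)
    (isClosed_eq (continuous_star'.comp (continuous_fst.mul continuous_snd))
      ((continuous_star'.comp continuous_snd).mul (continuous_star'.comp continuous_fst)))
    (fun a b => by simp only [← coeFun_mul, star_coeFun, star_mul]) x y

instance : CStarRing (MaxCStar P) where
  norm_mul_self_le x := denseRange_coeFun.induction_on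
    (p := fun x : MaxCStar P => ‖x‖ * ‖x‖ ≤ ‖star x * x‖) x
    (isClosed_le (continuous_norm.mul continuous_norm)
      (continuous_norm.comp (continuous_star'.mul continuous_id)))
    fun a => by
      simp only [star_coeFun, ← coeFun_mul, norm_coeFun]
      exact preMaxCStar_norm_mul_self_le P a

instance [StarModule ℂ P] : StarModule ℂ (MaxCStar P) where
  star_smul c x := denseRange_coeFun.induction_on
    (p := fun x : MaxCStar P => star (c • x) = star c • star x) x
    (isClosed_eq (continuous_star'.comp (continuous_const_smul c))
      (continuous_star'.const_smul (star c)))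
    fun a => by simp only [← coeFun_smul, star_coeFun, star_smul]

noncomputable instance [StarModule ℂ P] : CStarAlgebra (MaxCStar P) where

/-- The canonical `*`-homomorphism from `P` to its universal C⋆-algebra. -/
noncomputable def of (P : Type u) [Ring P] [StarRing P] [Algebra ℂ P] [HasMaxCStarNorm P] :
    P →⋆ₐ[ℂ] MaxCStar P where
  toFun x := coeFun P (toPreMaxCStar P x)
  map_one' := rfl
  map_mul' x y := by rw [map_mul, coeFun_mul]
  map_zero' := rfl
  map_add' x y := by rw [map_add, coeFun_add]
  commutes' _ := rfl
  map_star' x := by rw [map_star, star_coeFun]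

theorem norm_of (x : P) : ‖of P x‖ = maxCStarNorm P x := norm_coeFun (P := P) _

theorem denseRange_of : DenseRange (of P) := denseRange_coeFun (P := P)

end MaxCStar

end

end MaxCStar

/-! ### The full group C⋆-algebra -/

section GroupCStar

universe u

variable {Γ : Type u} [Group Γ]

theorem norm_groupAlgebra_single_le {D : Type*} [CStarAlgebra D] (π : MonoidAlgebra ℂ Γ →⋆ₐ[ℂ] D)
    (g : Γ) : ‖π (MonoidAlgebra.single g 1)‖ ≤ 1 := by
  have h : star (π (MonoidAlgebra.single g 1)) * π (MonoidAlgebra.single g 1) = 1 := by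
    rw [← map_star, ← map_mul, groupAlgebra_star_single, MonoidAlgebra.single_mul_single]
    simp [← MonoidAlgebra.one_def]
  have h2 := CStarRing.norm_star_mul_self (x := π (MonoidAlgebra.single g 1))
  rw [h] at h2
  have h3 : ‖(1 : D)‖ ≤ 1 := by
    have h4 := CStarRing.norm_star_mul_self (x := (1 : D))
    simp only [star_one, mul_one] at h4
    nlinarith [norm_nonneg (1 : D)]
  nlinarith [norm_nonneg (π (MonoidAlgebra.single g 1))]

instance groupAlgebra_hasMaxCStarNorm : HasMaxCStarNorm (MonoidAlgebra ℂ Γ) where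
  bddAbove x := by
    suffices h : ∃ C : ℝ, ∀ (D : Type u) [CStarAlgebra D] (π : MonoidAlgebra ℂ Γ →⋆ₐ[ℂ] D),
        ‖π x‖ ≤ C by
      obtain ⟨C, hC⟩ := h
      exact ⟨C, by rintro _ ⟨D, _, π, rfl⟩; exact hC D π⟩
    induction x using MonoidAlgebra.induction_linear with
    | zero => exact ⟨0, fun D _ π => by simp⟩
    | add x y hx hy =>
      obtain ⟨a, ha⟩ := hx
      obtain ⟨b, hb⟩ := hy
      exact ⟨a + b, fun D _ π => by
        rw [map_add]
        exact (norm_add_le _ _).trans (add_le_add (ha D π) (hb D π))⟩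
    | single g c =>
      refine ⟨‖c‖, fun D _ π => ?_⟩
      have hc : MonoidAlgebra.single g c = c • (MonoidAlgebra.single g (1 : ℂ)) := by simp
      rw [hc, map_smul, norm_smul]
      exact mul_le_of_le_one_right (norm_nonneg c) (norm_groupAlgebra_single_le π g)

/-- The full group C⋆-algebra `C*(Γ)`: the completion of `ℂΓ` for the maximal C⋆-norm. -/
abbrev GroupCStar (Γ : Type u) [Group Γ] : Type u := MaxCStar (MonoidAlgebra ℂ Γ)

/-- The canonical unitary of `C*(Γ)` attached to a group element. -/
noncomputable def GroupCStar.unit {Γ : Type u} [Group Γ] (g : Γ) : GroupCStar Γ :=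
  MaxCStar.of (MonoidAlgebra ℂ Γ) (MonoidAlgebra.single g 1)

end GroupCStar

/-! ### Compact quantum groups -/

section QuantumGroups

/-- A compact quantum group `G`, given by its Hopf `*`-algebra `Pol(G)` of representative
functions: a complex Hopf `*`-algebra which is spanned by the coefficients of its finite-dimensional
unitary corepresentations. -/
structure CompactQuantumGroup where
  /-- The `*`-algebra of representative functions. -/
  Pol : Type
  [ring : Ring Pol]
  [starRing : StarRing Pol]
  [hopfAlgebra : HopfAlgebra ℂ Pol]
  [starModule : StarModule ℂ Pol]
  comul_star : ∀ x : Pol,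
    Coalgebra.comul (R := ℂ) (star x) = star (Coalgebra.comul (R := ℂ) x)
  exists_corepresentation : ∀ x : Pol, ∃ (n : ℕ) (u : Matrix (Fin n) (Fin n) Pol),
    u ∈ unitary (Matrix (Fin n) (Fin n) Pol) ∧
    (∀ i j, Coalgebra.comul (R := ℂ) (u i j) = ∑ k, u i k ⊗ₜ[ℂ] u k j) ∧
    x ∈ Submodule.span ℂ (Set.range fun p : Fin n × Fin n => u p.1 p.2)

namespace CompactQuantumGroup

attribute [instance] CompactQuantumGroup.ring CompactQuantumGroup.starRing
  CompactQuantumGroup.hopfAlgebra CompactQuantumGroup.starModule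

theorem norm_coefficient_le {P : Type*} [Ring P] [StarRing P] [Algebra ℂ P] {n : ℕ}
    {u : Matrix (Fin n) (Fin n) P} (hu : u ∈ unitary (Matrix (Fin n) (Fin n) P))
    {D : Type*} [CStarAlgebra D] (π : P →⋆ₐ[ℂ] D) (i j : Fin n) : ‖π (u i j)‖ ≤ 1 := by
  let _ := CStarAlgebra.spectralOrder D
  have _ := CStarAlgebra.spectralOrderedRing D
  have h1 : ∑ k, star (π (u k j)) * π (u k j) = 1 := by
    have h := congrFun (congrFun (Unitary.mem_iff.mp hu).1 j) j
    rw [Matrix.mul_apply] at h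
    simp only [Matrix.star_apply, Matrix.one_apply_eq] at h
    rw [← map_one π, ← h, map_sum]
    exact Finset.sum_congr rfl fun k _ => by rw [map_mul, map_star]
  have h2 : star (π (u i j)) * π (u i j) ≤ 1 := by
    rw [← h1]
    exact Finset.single_le_sum (f := fun k => star (π (u k j)) * π (u k j))
      (fun k _ => star_mul_self_nonneg _) (Finset.mem_univ i)
  have h3 : ‖star (π (u i j)) * π (u i j)‖ ≤ 1 :=
    (CStarAlgebra.norm_le_one_iff_of_nonneg _ (star_mul_self_nonneg _)).2 h2
  rw [CStarRing.norm_star_mul_self] at h3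
  nlinarith [norm_nonneg (π (u i j))]

instance (G : CompactQuantumGroup) : HasMaxCStarNorm G.Pol where
  bddAbove x := by
    suffices h : ∃ C : ℝ, ∀ (D : Type) [CStarAlgebra D] (π : G.Pol →⋆ₐ[ℂ] D), ‖π x‖ ≤ C by
      obtain ⟨C, hC⟩ := h
      exact ⟨C, by rintro _ ⟨D, _, π, rfl⟩; exact hC D π⟩
    obtain ⟨n, u, hu, -, hx⟩ := G.exists_corepresentation x
    induction hx using Submodule.span_induction with
    | mem x hx =>
      obtain ⟨p, rfl⟩ := hx
      exact ⟨1, fun D _ π => norm_coefficient_le hu π _ _⟩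
    | zero => exact ⟨0, fun D _ π => by simp⟩
    | add x y _ _ hx hy =>
      obtain ⟨a, ha⟩ := hx
      obtain ⟨b, hb⟩ := hy
      exact ⟨a + b, fun D _ π => by
        rw [map_add]
        exact (norm_add_le _ _).trans (add_le_add (ha D π) (hb D π))⟩
    | smul c x _ hx =>
      obtain ⟨a, ha⟩ := hx
      exact ⟨‖c‖ * a, fun D _ π => by
        rw [map_smul, norm_smul]
        exact mul_le_mul_of_nonneg_left (ha D π) (norm_nonneg c)⟩

/-- The (full) C⋆-algebra `C(G)` of continuous functions on `G`: the universal C⋆-algebra of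
`Pol(G)`. -/
abbrev C (G : CompactQuantumGroup) : Type := MaxCStar G.Pol

/-- A morphism of quantum groups `H → G`, given by a morphism `Pol(G) → Pol(H)` of Hopf
`*`-algebras (a `*`-homomorphism which respects comultiplication and counit). -/
def IsHopfMorphism {G H : CompactQuantumGroup} (f : G.Pol →⋆ₐ[ℂ] H.Pol) : Prop :=
  (∀ x, Coalgebra.comul (R := ℂ) (f x) =
    TensorProduct.map f.toAlgHom.toLinearMap f.toAlgHom.toLinearMap
      (Coalgebra.comul (R := ℂ) x)) ∧
  ∀ x, Coalgebra.counit (R := ℂ) (f x) = Coalgebra.counit (R := ℂ) x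

end CompactQuantumGroup

/-! ### The spectral triple of a group dual, and its quantum isometry group -/

/-- The word length on `Γ` with respect to `S`. -/
noncomputable def wordLength {Γ : Type} [Group Γ] (S : Set Γ) (g : Γ) : ℕ :=
  sInf {r | ∃ L : List Γ, L.length = r ∧ (∀ h ∈ L, h ∈ S) ∧ L.prod = g}

/-- The Dirac operator `D(δ_g) = l(g) δ_g`, on the dense subspace `ℂΓ ⊆ ℓ²(Γ)`. For a finite
generating set the eigenspaces of its closure on `ℓ²(Γ)` are finite-dimensional and contained
in `ℂΓ`. -/
noncomputable def diracOperator {Γ : Type} [Group Γ] (S : Set Γ) :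
    MonoidAlgebra ℂ Γ →ₗ[ℂ] MonoidAlgebra ℂ Γ :=
  Finsupp.linearCombination ℂ (fun g : Γ => MonoidAlgebra.single g (wordLength S g : ℂ)) ∘ₗ
    (MonoidAlgebra.coeffLinearEquiv ℂ).toLinearMap

/-- An action of the compact quantum group `G` on `C*(Γ)`, given by the coaction
`α : ℂΓ → ℂΓ ⊗ Pol(G)`, which leaves invariant the eigenspaces of the Dirac operator and the
standard trace `tr(g) = δ_{g,1}`. -/
structure IsometricAction (Γ : Type) [Group Γ] (S : Set Γ) (G : CompactQuantumGroup) where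
  /-- The coaction. -/
  α : MonoidAlgebra ℂ Γ →⋆ₐ[ℂ] MonoidAlgebra ℂ Γ ⊗[ℂ] G.Pol
  /-- Coassociativity `(α ⊗ id)α = (id ⊗ Δ)α`. -/
  coassoc : ∀ x, TensorProduct.assoc ℂ _ _ _ (α.toAlgHom.toLinearMap.rTensor G.Pol (α x)) =
    (Coalgebra.comul (R := ℂ) (A := G.Pol)).lTensor (MonoidAlgebra ℂ Γ) (α x)
  /-- Counitality `(id ⊗ ε)α = id`. -/
  counit : ∀ x, TensorProduct.rid ℂ _
    ((Coalgebra.counit (R := ℂ) (A := G.Pol)).lTensor (MonoidAlgebra ℂ Γ) (α x)) = x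
  /-- `α(E) ⊆ E ⊗ Pol(G)` for every eigenspace `E` of the Dirac operator. -/
  eigenspace : ∀ (μ : ℂ), ∀ x ∈ Module.End.eigenspace (diracOperator S) μ,
    α x ∈ LinearMap.range ((Module.End.eigenspace (diracOperator S) μ).subtype.rTensor G.Pol)
  /-- `(tr ⊗ id)α = tr(·)1`. -/
  trace : ∀ x, TensorProduct.lid ℂ _
    ((Finsupp.lapply (1 : Γ) ∘ₗ (MonoidAlgebra.coeffLinearEquiv ℂ).toLinearMap).rTensor G.Pol
      (α x)) = x.coeff 1 • (1 : G.Pol)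

/-- `(G, a)` is the quantum isometry group `G⁺(Γ̂)` with its action: it is universal among the
compact quantum groups acting on `C*(Γ)` so that the eigenspaces of the Dirac operator and the
standard trace are invariant. -/
def IsometricAction.IsQuantumIsometryGroup {Γ : Type} [Group Γ] {S : Set Γ}
    {G : CompactQuantumGroup} (a : IsometricAction Γ S G) : Prop :=
  ∀ (H : CompactQuantumGroup) (b : IsometricAction Γ S H),
    ∃! f : G.Pol →⋆ₐ[ℂ] H.Pol, CompactQuantumGroup.IsHopfMorphism f ∧
      ∀ x, f.toAlgHom.toLinearMap.lTensor (MonoidAlgebra ℂ Γ) (a.α x) = b.α x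

end QuantumGroups

/-! An isometric action preserves the span of `g` and `g⁻¹`, the eigenspace for length one, so it
sends `g` to `g ⊗ x + g⁻¹ ⊗ y*`; applying the involution gives the image of `g⁻¹`. The relations on
`x` and `y` come from multiplicativity. Since `g²` is an eigenvector for length two, the coefficient
of `α(g)²` at `1` vanishes; since `g² = g⁻²`, the squares of `α(g)` and `α(g⁻¹)` agree; and `α(g)`,
`α(g⁻¹)` are mutually inverse. The key computation, `isotropicPair_of_relations`, condenses this:
with `T = x² + y²` one has `xy + yx = 0`, `T² = 1`, `x* = Tx` and `y* = Ty`.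

These relations present a group algebra. Anticommutation makes `T` commute with `x` and `y` and
gives `(x + y)² = (x - y)² = T`. The involution `T` has a square root `w` that is a polynomial in
`T`, with `w* = Tw`. Dividing by `w` turns `x ± y` into two involutions commuting with `T`, and
nothing else is imposed on them: this is `ℂ[D_∞ × ℤ₂]`, with `z = T`, `s₀ = w⁻¹(x + y)` and `s₁ =
w⁻¹(x - y)`. The universal property is `IsometryPol.lift`. `IsotropicPair` does not mention the
involution, so `lift` also serves for the counit and for the antipode, whose target is the opposite
algebra; `starLift` adds the involution.

The coproduct is not that of the group algebra: coassociativity of the action forces the matrix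
coproduct of `u = (A, B; B*, A*)`. Checked on `A` and `B`, it gives a compact quantum group with an
isometric action, and the presentation gives the unique morphism to any other one. Universal actions
are unique up to an isomorphism matching their coefficients, and the maximal C⋆-completion is
functorial, so the statement for an arbitrary universal action follows from the model. -/

/-! ### Homomorphisms out of `D_∞ × ℤ₂` -/

section Lift

variable {M : Type*} [Monoid M]

/-- The product of two involutions, as a unit. -/
def unitOfInvolutions {s t : M} (hs : s * s = 1) (ht : t * t = 1) : Mˣ where
  val := s * t
  inv := t * s
  val_inv := by rw [mul_assoc, ← mul_assoc t, ht, one_mul, hs]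
  inv_val := by rw [mul_assoc, ← mul_assoc s, hs, one_mul, ht]

/-- The powers of the product of two involutions. -/
def involutionPow {s t : M} (hs : s * s = 1) (ht : t * t = 1) (i : ℤ) : M :=
  (unitOfInvolutions hs ht ^ i : Mˣ)

section

variable {s t : M} (hs : s * s = 1) (ht : t * t = 1)

theorem involutionPow_zero : involutionPow hs ht 0 = 1 := by simp [involutionPow]

theorem involutionPow_one : involutionPow hs ht 1 = s * t := by
  rw [involutionPow, zpow_one]; rfl

theorem involutionPow_add (i j : ℤ) :
    involutionPow hs ht (i + j) = involutionPow hs ht i * involutionPow hs ht j := by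
  simp only [involutionPow, zpow_add, Units.val_mul]

/-- Conjugation by the involution `s` turns `st` into its inverse `ts`, hence inverts every power.
-/
theorem involutionPow_mul (i : ℤ) : involutionPow hs ht i * s = s * involutionPow hs ht (-i) := by
  let v : Mˣ := ⟨s, s, hs, hs⟩
  have h : SemiconjBy v (unitOfInvolutions hs ht ^ (-i)) (unitOfInvolutions hs ht ^ i) := by
    rw [zpow_neg, ← inv_zpow]
    refine SemiconjBy.zpow_right ?_ i
    ext
    change s * (t * s) = s * t * s
    rw [mul_assoc]
  exact (congrArg Units.val h.eq).symm

theorem Commute.involutionPow {z : M} (hzs : Commute z s) (hzt : Commute z t) (i : ℤ) :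
    Commute z (involutionPow hs ht i) :=
  Commute.units_zpow_right (u := unitOfInvolutions hs ht) (hzs.mul_right hzt) i

/-- The homomorphism from the infinite dihedral group given by two involutions. -/
def dihedralLift : DihedralGroup 0 →* M where
  toFun
    -- `ZMod 0` is `ℤ` by definition, so the index of a rotation is an integer exponent.
    | .r i => involutionPow hs ht i
    | .sr i => s * involutionPow hs ht i
  map_one' := involutionPow_zero hs ht
  map_mul' := by
    have key := involutionPow_mul hs ht
    have hadd := involutionPow_add hs ht
    have h1 (i j : ℤ) : s * involutionPow hs ht (j - i) =
        involutionPow hs ht i * (s * involutionPow hs ht j) := by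
      rw [← neg_add_eq_sub, hadd, ← mul_assoc, ← key, mul_assoc]
    have h2 (i j : ℤ) : s * involutionPow hs ht (i + j) =
        s * involutionPow hs ht i * involutionPow hs ht j := by rw [hadd, mul_assoc]
    have h3 (i j : ℤ) : involutionPow hs ht (j - i) =
        s * involutionPow hs ht i * (s * involutionPow hs ht j) := by
      rw [mul_assoc, ← h1, ← mul_assoc, hs, one_mul]
    rintro (i | i) (j | j)
    exacts [hadd i j, h1 i j, h2 i j, h3 i j]

theorem dihedralLift_sr_zero : dihedralLift hs ht (.sr 0) = s :=
  (congrArg (s * ·) (involutionPow_zero hs ht)).trans (mul_one s)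

theorem dihedralLift_sr_one : dihedralLift hs ht (.sr 1) = t := by
  refine (congrArg (s * ·) (involutionPow_one hs ht)).trans ?_
  simp only [← mul_assoc, hs, one_mul]

theorem commute_dihedralLift {z : M} (hzs : Commute z s) (hzt : Commute z t)
    (g : DihedralGroup 0) : Commute z (dihedralLift hs ht g) := by
  rcases g with i | i
  · exact hzs.involutionPow hs ht hzt i
  · exact hzs.mul_right (hzs.involutionPow hs ht hzt i)

end

/-- The homomorphism from the group with two elements given by an involution. -/
def zmodTwoLift {z : M} (hz : z * z = 1) : Multiplicative (ZMod 2) →* M where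
  toFun a := if a = 1 then 1 else z
  map_one' := if_pos rfl
  map_mul' a b := by
    have h (c : Multiplicative (ZMod 2)) : c = 1 ∨ c = Multiplicative.ofAdd 1 := by
      revert c; decide
    have h1 : (Multiplicative.ofAdd 1 : Multiplicative (ZMod 2)) ≠ 1 := by decide
    have h2 : (Multiplicative.ofAdd 1 * Multiplicative.ofAdd 1 : Multiplicative (ZMod 2)) = 1 := by
      decide
    rcases h a with rfl | rfl <;> rcases h b with rfl | rfl <;> simp [h1, h2, hz]

theorem zmodTwoLift_ofAdd_one {z : M} (hz : z * z = 1) :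
    zmodTwoLift hz (Multiplicative.ofAdd 1) = z := by
  have h : (Multiplicative.ofAdd 1 : Multiplicative (ZMod 2)) ≠ 1 := by decide
  simp [zmodTwoLift, h]

end Lift

/-- No inverses are needed: the two products of the generators are `r 1` and `r (-1)`, whose natural
powers are all the rotations. -/
theorem dihedralGroup_zero_closure :
    Submonoid.closure {DihedralGroup.sr 0, DihedralGroup.sr 1} =
      (⊤ : Submonoid (DihedralGroup 0)) := by
  set N := Submonoid.closure {DihedralGroup.sr 0, (DihedralGroup.sr 1 : DihedralGroup 0)}
  have h0 : DihedralGroup.sr 0 ∈ N := Submonoid.subset_closure (by simp)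
  have h1 : DihedralGroup.sr 1 ∈ N := Submonoid.subset_closure (by simp)
  have hr (i : ℤ) : (DihedralGroup.r i : DihedralGroup 0) ∈ N := by
    have hp : (DihedralGroup.r 1 : DihedralGroup 0) ∈ N := by
      simpa [DihedralGroup.sr_mul_sr] using mul_mem h0 h1
    have hm : (DihedralGroup.r (-1) : DihedralGroup 0) ∈ N := by
      simpa [DihedralGroup.sr_mul_sr] using mul_mem h1 h0
    obtain ⟨n, rfl | rfl⟩ := i.eq_nat_or_neg
    · have := pow_mem hp n
      rw [DihedralGroup.r_pow, one_mul] at this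
      exact this
    · have := pow_mem hm n
      rw [DihedralGroup.r_pow, neg_one_mul] at this
      exact this
  rw [eq_top_iff]
  rintro (i | i) -
  · exact hr i
  · have := mul_mem h0 (hr i)
    rw [DihedralGroup.sr_mul_r, zero_add] at this
    exact this

/-! ### The `*`-algebra of the quantum isometry group, and its presentation -/

/-- The relations of the coefficients of the fundamental corepresentation. -/
structure IsotropicPair {R : Type*} [Ring R] (x y : R) : Prop where
  anticomm : x * y + y * x = 0
  sq : (x * x + y * y) * (x * x + y * y) = 1

namespace IsotropicPair

variable {R : Type*} [Ring R] {x y : R} (h : IsotropicPair x y)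
include h

/-- Moving `x` past `y` twice costs two signs, so `x` commutes with `y²`. -/
theorem commute_left : Commute (x * x + y * y) x := by
  have := h.anticomm
  change (x * x + y * y) * x = x * (x * x + y * y)
  linear_combination (norm := noncomm_ring) y * this - this * y

theorem commute_right : Commute (x * x + y * y) y := by
  have := h.anticomm
  change (x * x + y * y) * y = y * (x * x + y * y)
  linear_combination (norm := noncomm_ring) x * this - this * x

/-- The cross terms are the anticommutator. Both `x + y` and `x - y` are thus square roots of the
same central involution, which is how a pair of involutions arises. -/
theorem add_mul_self : (x + y) * (x + y) = x * x + y * y := by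
  linear_combination (norm := noncomm_ring) h.anticomm

theorem sub_mul_self : (x - y) * (x - y) = x * x + y * y := by
  linear_combination (norm := noncomm_ring) - h.anticomm

end IsotropicPair

section SqrtInvolution

variable {R : Type*} [Ring R] [Algebra ℂ R]

/-- A square root of an involution `z`: it is `1` where `z = 1` and `-i` where `z = -1`. -/
noncomputable def sqrtInvolution (z : R) : R :=
  (1 / 2 : ℂ) • (1 + z) - (Complex.I / 2) • (1 - z)

/-- The elements `p = (1 + z)/2` and `q = (1 - z)/2` are complementary idempotents, and `(p - iq)² =
p - q = z`. -/
theorem sqrtInvolution_mul_self {z : R} (hz : z * z = 1) :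
    sqrtInvolution z * sqrtInvolution z = z := by
  have h1 : (1 + z) * (1 + z) = (2 : ℂ) • (1 + z) := by
    rw [two_smul]; linear_combination (norm := noncomm_ring) hz
  have h2 : (1 - z) * (1 - z) = (2 : ℂ) • (1 - z) := by
    rw [two_smul]; linear_combination (norm := noncomm_ring) hz
  have h3 : (1 + z) * (1 - z) = 0 := by linear_combination (norm := noncomm_ring) - hz
  have h4 : (1 - z) * (1 + z) = 0 := by linear_combination (norm := noncomm_ring) - hz
  -- Treating `1 + z` and `1 - z` as atoms keeps the expansion within the multiplication table
  -- `h1`–`h4`.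
  rw [sqrtInvolution]
  generalize hp : 1 + z = p at *
  generalize hq : 1 - z = q at *
  simp only [sub_mul, mul_sub, smul_mul_assoc, mul_smul_comm, h1, h2,
    h3, h4, smul_zero, sub_zero, zero_sub, smul_neg, sub_neg_eq_add, smul_smul]
  have h5 : Complex.I / 2 * (Complex.I / 2 * 2) = -(1 / 2) := by
    linear_combination (1 / 2) * Complex.I_mul_I
  rw [h5, ← hp, ← hq]
  module

theorem Commute.sqrtInvolution {z x : R} (h : Commute z x) : Commute (sqrtInvolution z) x :=
  ((((Commute.one_left x).add_left h).smul_left _).sub_left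
    (((Commute.one_left x).sub_left h).smul_left _))

theorem map_sqrtInvolution {S : Type*} [Ring S] [Algebra ℂ S] (f : R →ₐ[ℂ] S) (z : R) :
    f (sqrtInvolution z) = sqrtInvolution (f z) := by
  simp [sqrtInvolution]

/-- Where `z = 1` the root is real; where `z = -1` conjugation changes the sign of `-i`, which is
multiplication by `z`. -/
theorem star_sqrtInvolution [StarRing R] [StarModule ℂ R] {z : R} (hz : z * z = 1)
    (hs : star z = z) : star (sqrtInvolution z) = z * sqrtInvolution z := by
  have h1 : z * (1 + z) = 1 + z := by linear_combination (norm := noncomm_ring) hz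
  have h2 : z * (1 - z) = - (1 - z) := by linear_combination (norm := noncomm_ring) - hz
  simp only [sqrtInvolution, star_sub, star_smul, star_add, star_one, hs, mul_sub z (_ • _),
    mul_smul_comm, h1, h2, smul_neg]
  simp [neg_div, -neg_sub]

end SqrtInvolution

/-- The `*`-algebra of representative functions on the quantum isometry group of the dual of `ℤ₄`.
As a `*`-algebra this is the group algebra of `D_∞ × ℤ₂`, but it carries another coproduct. -/
def IsometryPol : Type := MonoidAlgebra ℂ (DihedralGroup 0 × Multiplicative (ZMod 2))

namespace IsometryPol

noncomputable instance : Ring IsometryPol :=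
  inferInstanceAs (Ring (MonoidAlgebra ℂ (DihedralGroup 0 × Multiplicative (ZMod 2))))

noncomputable instance : StarRing IsometryPol :=
  inferInstanceAs (StarRing (MonoidAlgebra ℂ (DihedralGroup 0 × Multiplicative (ZMod 2))))

noncomputable instance instAlgebra : Algebra ℂ IsometryPol :=
  inferInstanceAs (Algebra ℂ (MonoidAlgebra ℂ (DihedralGroup 0 × Multiplicative (ZMod 2))))

instance : StarModule ℂ IsometryPol :=
  inferInstanceAs (StarModule ℂ (MonoidAlgebra ℂ (DihedralGroup 0 × Multiplicative (ZMod 2))))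

/-- The identity map to the group algebra. -/
noncomputable def equivGroupAlgebra :
    IsometryPol ≃⋆ₐ[ℂ] MonoidAlgebra ℂ (DihedralGroup 0 × Multiplicative (ZMod 2)) where
  toFun x := x
  invFun x := x
  left_inv _ := rfl
  right_inv _ := rfl
  map_mul' _ _ := rfl
  map_add' _ _ := rfl
  map_star' _ := rfl
  map_smul' _ _ := rfl

/-- The elements of `D_∞ × ℤ₂` in the algebra. -/
noncomputable def ofGroup : DihedralGroup 0 × Multiplicative (ZMod 2) →* IsometryPol :=
  MonoidAlgebra.of ℂ (DihedralGroup 0 × Multiplicative (ZMod 2))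

theorem star_ofGroup (g : DihedralGroup 0 × Multiplicative (ZMod 2)) :
    star (ofGroup g) = ofGroup g⁻¹ :=
  (groupAlgebra_star_single g 1).trans (by rw [star_one]; rfl)

/-- The central involution. -/
noncomputable def z : IsometryPol := ofGroup (1, Multiplicative.ofAdd 1)

/-- The first generating involution of `D_∞`. -/
noncomputable def s₀ : IsometryPol := ofGroup (.sr 0, 1)

/-- The second generating involution of `D_∞`. -/
noncomputable def s₁ : IsometryPol := ofGroup (.sr 1, 1)

theorem z_mul_z : z * z = 1 := by
  rw [z, ← map_mul, ← map_one ofGroup]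
  exact congrArg ofGroup (Prod.ext (one_mul 1) (by decide))

theorem s₀_mul_s₀ : s₀ * s₀ = 1 := by
  rw [s₀, ← map_mul, ← map_one ofGroup]
  exact congrArg ofGroup (Prod.ext (DihedralGroup.sr_mul_self 0) (one_mul 1))

theorem s₁_mul_s₁ : s₁ * s₁ = 1 := by
  rw [s₁, ← map_mul, ← map_one ofGroup]
  exact congrArg ofGroup (Prod.ext (DihedralGroup.sr_mul_self 1) (one_mul 1))

theorem commute_z_s₀ : Commute z s₀ := by
  rw [z, s₀, Commute, SemiconjBy, ← map_mul, ← map_mul]; simp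

theorem commute_z_s₁ : Commute z s₁ := by
  rw [z, s₁, Commute, SemiconjBy, ← map_mul, ← map_mul]; simp

theorem star_z : star z = z := by
  rw [z, star_ofGroup]
  exact congrArg ofGroup (Prod.ext inv_one (by decide))

theorem star_s₀ : star s₀ = s₀ := by rw [s₀, star_ofGroup]; simp

theorem star_s₁ : star s₁ = s₁ := by rw [s₁, star_ofGroup]; simp

/-- The first coefficient of the fundamental corepresentation. -/
noncomputable def A : IsometryPol := (1 / 2 : ℂ) • (sqrtInvolution z * (s₀ + s₁))

/-- The second coefficient of the fundamental corepresentation. -/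
noncomputable def B : IsometryPol := (1 / 2 : ℂ) • (sqrtInvolution z * (s₀ - s₁))

theorem A_add_B : A + B = sqrtInvolution z * s₀ := by
  rw [A, B, ← smul_add, ← mul_add]
  have : s₀ + s₁ + (s₀ - s₁) = (2 : ℂ) • s₀ := by rw [two_smul]; abel
  rw [this, mul_smul_comm, smul_smul]
  norm_num

theorem A_sub_B : A - B = sqrtInvolution z * s₁ := by
  rw [A, B, ← smul_sub, ← mul_sub]
  have : s₀ + s₁ - (s₀ - s₁) = (2 : ℂ) • s₁ := by rw [two_smul]; abel
  rw [this, mul_smul_comm, smul_smul]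
  norm_num

theorem commute_z_A : Commute z A :=
  (((Commute.refl z).sqrtInvolution.symm).mul_right
    (commute_z_s₀.add_right commute_z_s₁)).smul_right _

theorem commute_z_B : Commute z B :=
  (((Commute.refl z).sqrtInvolution.symm).mul_right
    (commute_z_s₀.sub_right commute_z_s₁)).smul_right _

/-- The involutions `s₀`, `s₁` are self-adjoint and commute with `w`, so only `w* = zw` contributes.
-/
theorem star_A : star A = z * A := by
  have h := (commute_z_s₀.add_right commute_z_s₁).sqrtInvolution
  rw [A, star_smul, star_mul, star_add, star_s₀, star_s₁, star_sqrtInvolution z_mul_z star_z,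
    mul_smul_comm, ← mul_assoc, ← (commute_z_s₀.add_right commute_z_s₁).eq, mul_assoc, h.eq]
  simp

theorem star_B : star B = z * B := by
  have h := (commute_z_s₀.sub_right commute_z_s₁).sqrtInvolution
  rw [B, star_smul, star_mul, star_sub, star_s₀, star_s₁, star_sqrtInvolution z_mul_z star_z,
    mul_smul_comm, ← mul_assoc, ← (commute_z_s₀.sub_right commute_z_s₁).eq, mul_assoc, h.eq]
  simp

theorem A_add_B_mul_self : (A + B) * (A + B) = z := by
  rw [A_add_B, commute_z_s₀.sqrtInvolution.symm.mul_mul_mul_comm, s₀_mul_s₀, mul_one,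
    sqrtInvolution_mul_self z_mul_z]

theorem A_sub_B_mul_self : (A - B) * (A - B) = z := by
  rw [A_sub_B, commute_z_s₁.sqrtInvolution.symm.mul_mul_mul_comm, s₁_mul_s₁, mul_one,
    sqrtInvolution_mul_self z_mul_z]

theorem A_mul_A_add_B_mul_B : A * A + B * B = z := by
  have h : (2 : ℂ) • (A * A + B * B) = (2 : ℂ) • z := by
    rw [two_smul, two_smul]
    linear_combination (norm := noncomm_ring) A_add_B_mul_self + A_sub_B_mul_self
  exact smul_right_injective _ two_ne_zero h

theorem isotropicPair : IsotropicPair A B where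
  anticomm := by
    linear_combination (norm := noncomm_ring) A_add_B_mul_self - A_mul_A_add_B_mul_B
  sq := by rw [A_mul_A_add_B_mul_B, z_mul_z]

/-- The element `z = A² + B²` is available, hence so is `w`, and `w⁻¹ = zw` recovers `s₀` and `s₁`
from `A ± B`. From here on identities between homomorphisms need checking only on `A` and `B`. -/
theorem adjoin_eq_top : Algebra.adjoin ℂ {A, B} = ⊤ := by
  set N := Algebra.adjoin ℂ {A, B}
  have hA : A ∈ N := Algebra.subset_adjoin (by simp)
  have hB : B ∈ N := Algebra.subset_adjoin (by simp)
  have hz : z ∈ N := by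
    rw [← A_mul_A_add_B_mul_B]; exact add_mem (mul_mem hA hA) (mul_mem hB hB)
  have hw : sqrtInvolution z ∈ N :=
    sub_mem (N.smul_mem (add_mem (one_mem N) hz) _) (N.smul_mem (sub_mem (one_mem N) hz) _)
  have hs (s c : IsometryPol) (h : c = sqrtInvolution z * s) (hc : c ∈ N) : s ∈ N := by
    have : s = z * (sqrtInvolution z * c) := by
      rw [h, ← mul_assoc (sqrtInvolution z), sqrtInvolution_mul_self z_mul_z, ← mul_assoc,
        z_mul_z, one_mul]
    rw [this]
    exact mul_mem hz (mul_mem hw hc)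
  have h0 : s₀ ∈ N := hs _ _ A_add_B (add_mem hA hB)
  have h1 : s₁ ∈ N := hs _ _ A_sub_B (sub_mem hA hB)
  have hd (d : DihedralGroup 0) : ofGroup (d, 1) ∈ N := by
    have hd : d ∈ Submonoid.closure {DihedralGroup.sr 0, DihedralGroup.sr 1} := by
      rw [dihedralGroup_zero_closure]; trivial
    induction hd using Submonoid.closure_induction with
    | mem d hd =>
      rcases hd with rfl | rfl
      exacts [h0, h1]
    | one => exact (map_one ofGroup).symm ▸ one_mem N
    | mul d e _ _ hd he =>
      have : ((d * e, 1) : DihedralGroup 0 × Multiplicative (ZMod 2)) = (d, 1) * (e, 1) := by simp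
      rw [this, map_mul]
      exact mul_mem hd he
  have hc (c : Multiplicative (ZMod 2)) : ofGroup (1, c) ∈ N := by
    have h : c = 1 ∨ c = Multiplicative.ofAdd 1 := by revert c; decide
    rcases h with rfl | rfl
    exacts [hd 1, hz]
  rw [eq_top_iff]
  rintro x -
  induction x using MonoidAlgebra.induction_linear with
  | zero => exact zero_mem N
  | add x y hx hy => exact add_mem hx hy
  | single g c =>
    have h : (MonoidAlgebra.single g c : IsometryPol) =
        c • (ofGroup (g.1, 1) * ofGroup (1, g.2)) := by
      rw [← map_mul, Prod.mk_mul_mk, mul_one, one_mul]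
      change _ = c • MonoidAlgebra.single g (1 : ℂ)
      simp
    rw [h]
    exact N.smul_mem (mul_mem (hd _) (hc _)) c

theorem algHom_ext {R : Type*} [Ring R] [Algebra ℂ R] {f g : IsometryPol →ₐ[ℂ] R}
    (hA : f A = g A) (hB : f B = g B) : f = g :=
  AlgHom.ext_of_adjoin_eq_top adjoin_eq_top (by rintro _ (rfl | rfl) <;> assumption)

section Lift

variable {R : Type*} [Ring R] [Algebra ℂ R] {x y : R} (h : IsotropicPair x y)

/-- As `T² = 1` and `w² = T`, the factor `Tw` is `w⁻¹`; it commutes with `c` because `T = c²` does.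
So the square is `T⁻¹c² = 1`. -/
theorem involution_of_sq {T c : R} (hT : T * T = 1) (hc : c * c = T) :
    (T * sqrtInvolution T * c) * (T * sqrtInvolution T * c) = 1 := by
  have hTc : Commute T c := by rw [← hc]; exact (Commute.refl c).mul_left (Commute.refl c)
  have hTw : Commute T (sqrtInvolution T) := (Commute.refl T).sqrtInvolution.symm
  rw [(hTc.mul_left hTc.sqrtInvolution).symm.mul_mul_mul_comm, hTw.symm.mul_mul_mul_comm, hT,
    one_mul,
    sqrtInvolution_mul_self hT, hc, hT]

/-- The homomorphism of the underlying group given by an isotropic pair. -/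
noncomputable def liftGroup : DihedralGroup 0 × Multiplicative (ZMod 2) →* R :=
  (dihedralLift (involution_of_sq h.sq h.add_mul_self)
    (involution_of_sq h.sq h.sub_mul_self)).noncommCoprod (zmodTwoLift h.sq) fun d c => by
      -- `T` commutes with `x ± y` and with every polynomial in `T`, hence with both involutions and
      -- with the image of `D_∞`.
      have hT := Commute.refl (x * x + y * y)
      have h1 := hT.mul_right hT.sqrtInvolution.symm
      have key := commute_dihedralLift (involution_of_sq h.sq h.add_mul_self)
        (involution_of_sq h.sq h.sub_mul_self)
        (h1.mul_right (h.commute_left.add_right h.commute_right))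
        (h1.mul_right (h.commute_left.sub_right h.commute_right)) d
      rcases eq_or_ne c 1 with rfl | hc
      · rw [map_one]; exact Commute.one_right _
      · obtain rfl : c = Multiplicative.ofAdd 1 := by revert c; decide
        rw [zmodTwoLift_ofAdd_one]
        exact key.symm

/-- The universal property of the algebra. -/
noncomputable def lift : IsometryPol →ₐ[ℂ] R :=
  MonoidAlgebra.lift ℂ R (DihedralGroup 0 × Multiplicative (ZMod 2)) (liftGroup h)

theorem lift_ofGroup (g : DihedralGroup 0 × Multiplicative (ZMod 2)) :
    lift h (ofGroup g) = liftGroup h g := MonoidAlgebra.lift_of _ _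

theorem lift_z : lift h z = x * x + y * y := by
  rw [z, lift_ofGroup, liftGroup, MonoidHom.noncommCoprod_apply, zmodTwoLift_ofAdd_one, map_one,
    one_mul]

theorem lift_s₀ : lift h s₀ =
    (x * x + y * y) * sqrtInvolution (x * x + y * y) * (x + y) := by
  rw [s₀, lift_ofGroup, liftGroup, MonoidHom.noncommCoprod_apply, dihedralLift_sr_zero, map_one,
    mul_one]

theorem lift_s₁ : lift h s₁ =
    (x * x + y * y) * sqrtInvolution (x * x + y * y) * (x - y) := by
  rw [s₁, lift_ofGroup, liftGroup, MonoidHom.noncommCoprod_apply, dihedralLift_sr_one, map_one,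
    mul_one]

theorem sqrtInvolution_cancel {T : R} (hT : T * T = 1) (c : R) :
    sqrtInvolution T * (T * sqrtInvolution T * c) = c := by
  rw [← mul_assoc, ← mul_assoc, (Commute.refl T).sqrtInvolution.eq, mul_assoc T,
    sqrtInvolution_mul_self hT, hT, one_mul]

theorem lift_A : lift h A = x := by
  rw [A, map_smul, map_mul, map_add, map_sqrtInvolution, lift_z, lift_s₀, lift_s₁, ← mul_add,
    sqrtInvolution_cancel h.sq, add_add_sub_cancel, ← two_smul ℂ, smul_smul]
  norm_num

theorem lift_B : lift h B = y := by
  rw [B, map_smul, map_mul, map_sub, map_sqrtInvolution, lift_z, lift_s₀, lift_s₁, ← mul_sub,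
    sqrtInvolution_cancel h.sq, add_sub_sub_cancel, ← two_smul ℂ, smul_smul]
  norm_num

/-- The universal property of the `*`-algebra. -/
noncomputable def starLift [StarRing R] [StarModule ℂ R] (hx : star x = (x * x + y * y) * x)
    (hy : star y = (x * x + y * y) * y) : IsometryPol →⋆ₐ[ℂ] R where
  __ := lift h
  map_star' a := by
    change lift h (star a) = star (lift h a)
    have ha : a ∈ Algebra.adjoin ℂ {A, B} := by rw [adjoin_eq_top]; trivial
    induction ha using Algebra.adjoin_induction with
    | mem a ha =>
      rcases ha with rfl | rfl
      · rw [star_A, map_mul, lift_z, lift_A, hx]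
      · rw [star_B, map_mul, lift_z, lift_B, hy]
    | algebraMap c => rw [← algebraMap_star_comm, AlgHom.commutes, AlgHom.commutes,
        algebraMap_star_comm]
    | add a b _ _ ha hb => rw [star_add, map_add, ha, hb, map_add, star_add]
    | mul a b _ _ ha hb => rw [star_mul, map_mul, ha, hb, map_mul, star_mul]

end Lift

end IsometryPol

/-! ### The compact quantum group -/

namespace IsometryPol

/-- This rule and those up to `B_mul_B` bring products of the generators to a normal form: `z` in
front, `A` before `B`, and `B²` eliminated. The tensor identities below then hold by `abel`. -/
theorem A_mul_z : A * z = z * A := commute_z_A.eq.symm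

theorem A_mul_z_mul (x : IsometryPol) : A * (z * x) = z * (A * x) := by
  rw [← mul_assoc, A_mul_z, mul_assoc]

theorem B_mul_z : B * z = z * B := commute_z_B.eq.symm

theorem B_mul_z_mul (x : IsometryPol) : B * (z * x) = z * (B * x) := by
  rw [← mul_assoc, B_mul_z, mul_assoc]

theorem z_mul_z_mul (x : IsometryPol) : z * (z * x) = x := by
  rw [← mul_assoc, z_mul_z, one_mul]

theorem B_mul_A : B * A = -(A * B) := by
  linear_combination (norm := noncomm_ring) isotropicPair.anticomm

theorem B_mul_B : B * B = z - A * A := by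
  linear_combination (norm := noncomm_ring) A_mul_A_add_B_mul_B

/-- The prospective images of `A` and `B` are the first row of the matrix coproduct, with `zB = B*`
and `zA = A*`. In the sum of their squares the mixed terms form `(AB + BA) ⊗ z(AB + BA) = 0`, and
the rest is `(A² + B²) ⊗ (A² + B²)`. -/
theorem comul_aux : (A ⊗ₜ[ℂ] A + B ⊗ₜ[ℂ] (z * B)) * (A ⊗ₜ[ℂ] A + B ⊗ₜ[ℂ] (z * B)) +
    (A ⊗ₜ[ℂ] B + B ⊗ₜ[ℂ] (z * A)) * (A ⊗ₜ[ℂ] B + B ⊗ₜ[ℂ] (z * A)) = z ⊗ₜ[ℂ] z := by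
  simp only [add_mul, mul_add, Algebra.TensorProduct.tmul_mul_tmul, mul_assoc, A_mul_z_mul,
    B_mul_z_mul, z_mul_z_mul, B_mul_A, mul_neg, B_mul_B, mul_sub, TensorProduct.tmul_neg,
    TensorProduct.neg_tmul, TensorProduct.tmul_sub, TensorProduct.sub_tmul, z_mul_z, mul_one]
  abel

theorem comul_isotropicPair :
    IsotropicPair (A ⊗ₜ[ℂ] A + B ⊗ₜ[ℂ] (z * B)) (A ⊗ₜ[ℂ] B + B ⊗ₜ[ℂ] (z * A)) where
  anticomm := by
    simp only [add_mul, mul_add, Algebra.TensorProduct.tmul_mul_tmul, mul_assoc, A_mul_z_mul,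
      B_mul_z_mul, z_mul_z_mul, B_mul_A, mul_neg, B_mul_B, mul_sub, TensorProduct.tmul_neg,
      TensorProduct.neg_tmul, TensorProduct.tmul_sub, TensorProduct.sub_tmul, z_mul_z]
    abel
  sq := by
    rw [comul_aux, Algebra.TensorProduct.tmul_mul_tmul, z_mul_z, Algebra.TensorProduct.one_def]

/-- The comultiplication. -/
noncomputable def comulHom : IsometryPol →⋆ₐ[ℂ] IsometryPol ⊗[ℂ] IsometryPol :=
  starLift comul_isotropicPair
    (by
      rw [comul_aux]
      simp only [star_add, TensorProduct.star_tmul, mul_add, Algebra.TensorProduct.tmul_mul_tmul,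
        star_A, star_B, star_mul, star_z, mul_assoc, B_mul_z, z_mul_z_mul])
    (by
      rw [comul_aux]
      simp only [star_add, TensorProduct.star_tmul, mul_add, Algebra.TensorProduct.tmul_mul_tmul,
        star_A, star_B, star_mul, star_z, mul_assoc, A_mul_z, z_mul_z_mul])

theorem comulHom_A : comulHom A = A ⊗ₜ[ℂ] A + B ⊗ₜ[ℂ] (z * B) := lift_A comul_isotropicPair

theorem comulHom_B : comulHom B = A ⊗ₜ[ℂ] B + B ⊗ₜ[ℂ] (z * A) := lift_B comul_isotropicPair

theorem comulHom_z : comulHom z = z ⊗ₜ[ℂ] z := (lift_z comul_isotropicPair).trans comul_aux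

theorem counit_isotropicPair : IsotropicPair (1 : ℂ) 0 := ⟨by simp, by simp⟩

/-- The counit. -/
noncomputable def counitHom : IsometryPol →ₐ[ℂ] ℂ := lift counit_isotropicPair

theorem counitHom_A : counitHom A = 1 := lift_A counit_isotropicPair

theorem counitHom_B : counitHom B = 0 := lift_B counit_isotropicPair

theorem counitHom_z : counitHom z = 1 := (lift_z counit_isotropicPair).trans (by simp)

theorem antipode_aux : MulOpposite.op (z * A) * MulOpposite.op (z * A) +
    MulOpposite.op B * MulOpposite.op B = MulOpposite.op z := by
  rw [← MulOpposite.op_mul, ← MulOpposite.op_mul, ← MulOpposite.op_add, mul_assoc, A_mul_z_mul,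
    z_mul_z_mul, A_mul_A_add_B_mul_B]

/-- Unitarity of `u` dictates an antipode sending `u i j` to `(u j i)*`: thus `A` goes to `A* = zA`,
and `B` to `(B*)* = B`. -/
theorem antipode_isotropicPair :
    IsotropicPair (MulOpposite.op (z * A)) (MulOpposite.op B) where
  anticomm := by
    rw [← MulOpposite.op_mul, ← MulOpposite.op_mul, ← MulOpposite.op_add, B_mul_z_mul, B_mul_A,
      mul_assoc, mul_neg, neg_add_cancel, MulOpposite.op_zero]
  sq := by rw [antipode_aux, ← MulOpposite.op_mul, z_mul_z, MulOpposite.op_one]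

/-- The antipode, as an antihomomorphism. -/
noncomputable def antipodeHom : IsometryPol →ₐ[ℂ] IsometryPolᵐᵒᵖ := lift antipode_isotropicPair

/-- The antipode. -/
noncomputable def antipodeLinear : IsometryPol →ₗ[ℂ] IsometryPol :=
  (MulOpposite.opLinearEquiv ℂ).symm.toLinearMap ∘ₗ antipodeHom.toLinearMap

theorem antipodeLinear_A : antipodeLinear A = z * A :=
  congrArg MulOpposite.unop (lift_A antipode_isotropicPair)

theorem antipodeLinear_B : antipodeLinear B = B :=
  congrArg MulOpposite.unop (lift_B antipode_isotropicPair)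

theorem antipodeLinear_z : antipodeLinear z = z :=
  congrArg MulOpposite.unop ((lift_z antipode_isotropicPair).trans antipode_aux)

theorem antipodeLinear_mul (x y : IsometryPol) :
    antipodeLinear (x * y) = antipodeLinear y * antipodeLinear x :=
  congrArg MulOpposite.unop (map_mul antipodeHom x y)

theorem antipodeLinear_algebraMap (c : ℂ) :
    antipodeLinear (algebraMap ℂ _ c) = algebraMap ℂ _ c :=
  congrArg MulOpposite.unop (antipodeHom.commutes c)

/-- The comultiplication, as an algebra homomorphism. -/
noncomputable def comulAlg : IsometryPol →ₐ[ℂ] IsometryPol ⊗[ℂ] IsometryPol := comulHom.toAlgHom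

theorem comulAlg_A : comulAlg A = A ⊗ₜ[ℂ] A + B ⊗ₜ[ℂ] (z * B) := comulHom_A

theorem comulAlg_B : comulAlg B = A ⊗ₜ[ℂ] B + B ⊗ₜ[ℂ] (z * A) := comulHom_B

theorem comulAlg_z : comulAlg z = z ⊗ₜ[ℂ] z := comulHom_z

theorem comulAlg_z_mul_A : comulAlg (z * A) = (z * A) ⊗ₜ[ℂ] (z * A) + (z * B) ⊗ₜ[ℂ] B := by
  rw [map_mul, comulAlg_z, comulAlg_A, mul_add, Algebra.TensorProduct.tmul_mul_tmul,
    Algebra.TensorProduct.tmul_mul_tmul, z_mul_z_mul]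

theorem comulAlg_z_mul_B : comulAlg (z * B) = (z * A) ⊗ₜ[ℂ] (z * B) + (z * B) ⊗ₜ[ℂ] A := by
  rw [map_mul, comulAlg_z, comulAlg_B, mul_add, Algebra.TensorProduct.tmul_mul_tmul,
    Algebra.TensorProduct.tmul_mul_tmul, z_mul_z_mul]

theorem comulAlg_coassoc :
    (Algebra.TensorProduct.assoc ℂ ℂ ℂ IsometryPol IsometryPol IsometryPol).toAlgHom.comp
      ((Algebra.TensorProduct.map comulAlg (.id ℂ IsometryPol)).comp comulAlg) =
      (Algebra.TensorProduct.map (.id ℂ IsometryPol) comulAlg).comp comulAlg := by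
  apply algHom_ext
  · simp only [AlgHom.comp_apply, comulAlg_A, map_add, Algebra.TensorProduct.map_tmul,
      comulAlg_B, comulAlg_z_mul_B, AlgHom.id_apply, TensorProduct.add_tmul,
      TensorProduct.tmul_add, AlgEquiv.toAlgHom_apply, Algebra.TensorProduct.assoc_tmul]
    abel
  · simp only [AlgHom.comp_apply, comulAlg_A, map_add, Algebra.TensorProduct.map_tmul,
      comulAlg_B, comulAlg_z_mul_A, AlgHom.id_apply, TensorProduct.add_tmul,
      TensorProduct.tmul_add, AlgEquiv.toAlgHom_apply, Algebra.TensorProduct.assoc_tmul]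
    abel

theorem counitHom_rTensor :
    (Algebra.TensorProduct.map counitHom (.id ℂ IsometryPol)).comp comulAlg =
      (Algebra.TensorProduct.lid ℂ IsometryPol).symm := by
  apply algHom_ext <;> simp [comulAlg_A, comulAlg_B, counitHom_A, counitHom_B]

theorem counitHom_lTensor :
    (Algebra.TensorProduct.map (.id ℂ IsometryPol) counitHom).comp comulAlg =
      (Algebra.TensorProduct.rid ℂ ℂ IsometryPol).symm := by
  apply algHom_ext <;>
  simp [comulAlg_A, comulAlg_B, counitHom_A, counitHom_B, counitHom_z]

theorem antipodeLinear_one : antipodeLinear 1 = 1 :=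
  congrArg MulOpposite.unop (map_one antipodeHom)

noncomputable instance : Bialgebra ℂ IsometryPol :=
  Bialgebra.ofAlgHom comulAlg counitHom comulAlg_coassoc counitHom_rTensor counitHom_lTensor

end IsometryPol

/-- Since `S` reverses products, the contraction of `u` appears in the middle of `S(a) · S(u₁)u₂ ·
b`; being a scalar, it can be pulled out. The antipode axiom therefore passes to products and needs
checking only on generators. -/
theorem mul_rTensor_mul {P : Type*} [Ring P] [Algebra ℂ P] {S : P →ₗ[ℂ] P}
    (hS : ∀ x y, S (x * y) = S y * S x) {u : P ⊗[ℂ] P} {c : ℂ}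
    (hu : LinearMap.mul' ℂ P (S.rTensor P u) = algebraMap ℂ P c) (v : P ⊗[ℂ] P) :
    LinearMap.mul' ℂ P (S.rTensor P (u * v)) = c • LinearMap.mul' ℂ P (S.rTensor P v) := by
  have key (u : P ⊗[ℂ] P) (a b : P) : LinearMap.mul' ℂ P (S.rTensor P (u * a ⊗ₜ b)) =
      S a * LinearMap.mul' ℂ P (S.rTensor P u) * b := by
    induction u with
    | zero => simp
    | add u v hu hv => rw [add_mul, map_add, map_add, hu, hv, map_add, map_add, mul_add, add_mul]
    | tmul x y => simp [hS, mul_assoc]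
  induction v with
  | zero => simp
  | add v w hv hw => rw [mul_add, map_add, map_add, hv, hw, map_add, map_add, smul_add]
  | tmul a b => rw [key, hu, ← Algebra.commutes, ← Algebra.smul_def]; simp

theorem mul_lTensor_mul {P : Type*} [Ring P] [Algebra ℂ P] {S : P →ₗ[ℂ] P}
    (hS : ∀ x y, S (x * y) = S y * S x) (u : P ⊗[ℂ] P) {v : P ⊗[ℂ] P} {c : ℂ}
    (hv : LinearMap.mul' ℂ P (S.lTensor P v) = algebraMap ℂ P c) :
    LinearMap.mul' ℂ P (S.lTensor P (u * v)) = c • LinearMap.mul' ℂ P (S.lTensor P u) := by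
  have key (v : P ⊗[ℂ] P) (a b : P) : LinearMap.mul' ℂ P (S.lTensor P (a ⊗ₜ b * v)) =
      a * LinearMap.mul' ℂ P (S.lTensor P v) * S b := by
    induction v with
    | zero => simp
    | add u v hu hv => rw [mul_add, map_add, map_add, hu, hv, map_add, map_add, mul_add, add_mul]
    | tmul x y => simp [hS, mul_assoc]
  induction u with
  | zero => simp
  | add v w hv hw => rw [add_mul, map_add, map_add, hv, hw, map_add, map_add, smul_add]
  | tmul a b => rw [key, hv, ← Algebra.commutes, ← Algebra.smul_def]; simp

/-! ### The Hopf algebra structure of the model. -/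

namespace IsometryPol

theorem comul_A : Coalgebra.comul (R := ℂ) A = A ⊗ₜ[ℂ] A + B ⊗ₜ[ℂ] (z * B) := comulHom_A

theorem comul_B : Coalgebra.comul (R := ℂ) B = A ⊗ₜ[ℂ] B + B ⊗ₜ[ℂ] (z * A) := comulHom_B

theorem comul_z : Coalgebra.comul (R := ℂ) z = z ⊗ₜ[ℂ] z := comulHom_z

theorem counit_A : Coalgebra.counit (R := ℂ) A = 1 := counitHom_A

theorem counit_B : Coalgebra.counit (R := ℂ) B = 0 := counitHom_B

theorem counit_z : Coalgebra.counit (R := ℂ) z = 1 := counitHom_z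

theorem antipode_comul (x : IsometryPol) :
    LinearMap.mul' ℂ _ (antipodeLinear.rTensor _ (Coalgebra.comul (R := ℂ) x)) =
      algebraMap ℂ _ (Coalgebra.counit (R := ℂ) x) := by
  have hx : x ∈ Algebra.adjoin ℂ {A, B} := by rw [adjoin_eq_top]; trivial
  induction hx using Algebra.adjoin_induction with
  | mem x hx =>
    rcases hx with rfl | rfl
    · simp [comul_A, antipodeLinear_A, antipodeLinear_B, counit_A, mul_assoc, B_mul_z_mul,
        ← mul_add, A_mul_A_add_B_mul_B, z_mul_z]
    · simp [comul_B, antipodeLinear_A, antipodeLinear_B, counit_B, mul_assoc, B_mul_z_mul,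
        B_mul_A]
  | algebraMap c => simp [Algebra.TensorProduct.algebraMap_apply, antipodeLinear_algebraMap]
  | add x y _ _ hx hy => simp only [map_add, hx, hy]
  | mul x y _ _ hx hy =>
    rw [Bialgebra.comul_mul, mul_rTensor_mul antipodeLinear_mul hx, hy, Bialgebra.counit_mul,
      map_mul, Algebra.smul_def]

theorem comul_antipode (x : IsometryPol) :
    LinearMap.mul' ℂ _ (antipodeLinear.lTensor _ (Coalgebra.comul (R := ℂ) x)) =
      algebraMap ℂ _ (Coalgebra.counit (R := ℂ) x) := by
  have hx : x ∈ Algebra.adjoin ℂ {A, B} := by rw [adjoin_eq_top]; trivial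
  induction hx using Algebra.adjoin_induction with
  | mem x hx =>
    rcases hx with rfl | rfl
    · simp [comul_A, antipodeLinear_A, antipodeLinear_B, antipodeLinear_z, antipodeLinear_mul,
        counit_A, A_mul_z_mul, B_mul_z, B_mul_z_mul, ← mul_add, A_mul_A_add_B_mul_B, z_mul_z]
    · simp [comul_B, antipodeLinear_A, antipodeLinear_B, antipodeLinear_z, antipodeLinear_mul,
        counit_B, mul_assoc, A_mul_z, z_mul_z_mul, B_mul_A]
  | algebraMap c => simp [Algebra.TensorProduct.algebraMap_apply, antipodeLinear_one]
  | add x y _ _ hx hy => simp only [map_add, hx, hy]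
  | mul x y _ _ hx hy =>
    rw [Bialgebra.comul_mul, mul_lTensor_mul antipodeLinear_mul _ hy, hx, Bialgebra.counit_mul,
      mul_comm, map_mul, Algebra.smul_def]

noncomputable instance : HopfAlgebra ℂ IsometryPol where
  __ := (inferInstance : Bialgebra ℂ IsometryPol)
  antipode := antipodeLinear
  mul_antipode_rTensor_comul := LinearMap.ext antipode_comul
  mul_antipode_lTensor_comul := LinearMap.ext comul_antipode

end IsometryPol

/-! ### Unitary corepresentations and the algebra of their coefficients. -/

section Corepresentation

variable {P : Type*} [Ring P] [StarRing P] [HopfAlgebra ℂ P]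

/-- A finite-dimensional unitary corepresentation, as a matrix. -/
structure IsUnitaryCorepresentation {ι : Type*} [Fintype ι] [DecidableEq ι] (u : Matrix ι ι P) :
    Prop where
  star_mul : star u * u = 1
  mul_star : u * star u = 1
  comul : ∀ i j, Coalgebra.comul (R := ℂ) (u i j) = ∑ k, u i k ⊗ₜ[ℂ] u k j

/-- The span of the coefficients of a matrix. -/
def coefficientSpan {ι : Type*} (u : Matrix ι ι P) : Submodule ℂ P :=
  Submodule.span ℂ (Set.range fun p : ι × ι => u p.1 p.2)

namespace IsUnitaryCorepresentation

variable {ι κ : Type*} [Fintype ι] [DecidableEq ι] [Fintype κ] [DecidableEq κ]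

theorem submatrix {u : Matrix ι ι P} (hu : IsUnitaryCorepresentation u) (e : κ ≃ ι) :
    IsUnitaryCorepresentation (u.submatrix e e) where
  star_mul := by
    rw [Matrix.star_eq_conjTranspose, Matrix.conjTranspose_submatrix, Matrix.submatrix_mul_equiv,
      ← Matrix.star_eq_conjTranspose, hu.star_mul, Matrix.submatrix_one_equiv]
  mul_star := by
    rw [Matrix.star_eq_conjTranspose, Matrix.conjTranspose_submatrix, Matrix.submatrix_mul_equiv,
      ← Matrix.star_eq_conjTranspose, hu.mul_star, Matrix.submatrix_one_equiv]
  comul i j := by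
    simp only [Matrix.submatrix_apply, hu.comul]
    exact (e.sum_comp fun k => u (e i) k ⊗ₜ[ℂ] u k (e j)).symm

theorem fromBlocks {u : Matrix ι ι P} {v : Matrix κ κ P} (hu : IsUnitaryCorepresentation u)
    (hv : IsUnitaryCorepresentation v) :
    IsUnitaryCorepresentation (Matrix.fromBlocks u 0 0 v) where
  star_mul := by
    have h1 := hu.star_mul
    have h2 := hv.star_mul
    rw [Matrix.star_eq_conjTranspose] at h1 h2 ⊢
    simp [Matrix.fromBlocks_conjTranspose, Matrix.fromBlocks_multiply, h1, h2]
  mul_star := by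
    have h1 := hu.mul_star
    have h2 := hv.mul_star
    rw [Matrix.star_eq_conjTranspose] at h1 h2 ⊢
    simp [Matrix.fromBlocks_conjTranspose, Matrix.fromBlocks_multiply, h1, h2]
  comul := by
    rintro (i | i) (j | j) <;> simp [hu.comul, hv.comul]

/-- The tensor product of two matrices with entries in a noncommutative ring. -/
def _root_.corepresentationTensor (u : Matrix ι ι P) (v : Matrix κ κ P) :
    Matrix (ι × κ) (ι × κ) P :=
  Matrix.of fun p q => u p.1 q.1 * v p.2 q.2

theorem tensor {u : Matrix ι ι P} {v : Matrix κ κ P} (hu : IsUnitaryCorepresentation u)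
    (hv : IsUnitaryCorepresentation v) :
    IsUnitaryCorepresentation (corepresentationTensor u v) where
  star_mul := by
    have h1 (i j : ι) : ∑ k, star (u k i) * u k j = (1 : Matrix ι ι P) i j := by
      rw [← hu.star_mul]; rfl
    have h2 (i j : κ) : ∑ k, star (v k i) * v k j = (1 : Matrix κ κ P) i j := by
      rw [← hv.star_mul]; rfl
    ext ⟨i, k⟩ ⟨j, l⟩
    -- The adjoint of `u v` is `v* u*`, so the factors `u* u` meet in the middle and the index of
    -- `u` must be summed first. For `mul_star` the order is opposite.
    have h3 (m : κ) : ∑ n, star (u n i * v m k) * (u n j * v m l) =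
        star (v m k) * (1 : Matrix ι ι P) i j * v m l := by
      rw [← h1, Finset.mul_sum, Finset.sum_mul]
      simp only [StarMul.star_mul, mul_assoc]
    simp only [corepresentationTensor, Matrix.mul_apply, Matrix.star_apply, Matrix.of_apply,
      Fintype.sum_prod_type_right, h3]
    by_cases hij : i = j
    · subst hij
      simp [h2, Matrix.one_apply]
    · simp [hij]
  mul_star := by
    have h1 (i j : ι) : ∑ k, u i k * star (u j k) = (1 : Matrix ι ι P) i j := by
      rw [← hu.mul_star]; rfl
    have h2 (i j : κ) : ∑ k, v i k * star (v j k) = (1 : Matrix κ κ P) i j := by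
      rw [← hv.mul_star]; rfl
    ext ⟨i, k⟩ ⟨j, l⟩
    have h3 (n : ι) : ∑ m, u i n * v k m * star (u j n * v l m) =
        u i n * (1 : Matrix κ κ P) k l * star (u j n) := by
      rw [← h2, Finset.mul_sum, Finset.sum_mul]
      simp only [StarMul.star_mul, mul_assoc]
    simp only [corepresentationTensor, Matrix.mul_apply, Matrix.star_apply, Matrix.of_apply,
      Fintype.sum_prod_type, h3]
    by_cases hkl : k = l
    · subst hkl
      simp [h1, Matrix.one_apply]
    · simp [hkl]
  comul := by
    rintro ⟨i, k⟩ ⟨j, l⟩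
    simp only [corepresentationTensor, Matrix.of_apply, Bialgebra.comul_mul, hu.comul, hv.comul,
      Finset.sum_mul_sum, Algebra.TensorProduct.tmul_mul_tmul, Fintype.sum_prod_type]

end IsUnitaryCorepresentation

theorem apply_mem_coefficientSpan {P ι : Type*} [Ring P] [HopfAlgebra ℂ P] (u : Matrix ι ι P)
    (i j : ι) :
    u i j ∈ coefficientSpan u := Submodule.subset_span ⟨(i, j), rfl⟩

variable (P) in
/-- The subalgebra spanned by the coefficients of the finite-dimensional unitary
corepresentations. -/
def coefficientSubalgebra : Subalgebra ℂ P where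
  carrier := {x | ∃ (n : ℕ) (u : Matrix (Fin n) (Fin n) P),
    IsUnitaryCorepresentation u ∧ x ∈ coefficientSpan u}
  -- Constants come from the trivial corepresentation, sums from direct sums, and products from
  -- tensor products, reindexed by `Fin`.
  algebraMap_mem' c := by
    refine ⟨1, 1, ⟨by simp, by simp, fun i j => ?_⟩, ?_⟩
    · obtain rfl := Subsingleton.elim i 0
      obtain rfl := Subsingleton.elim j 0
      simp [Matrix.one_apply, Algebra.TensorProduct.one_def]
    · rw [Algebra.algebraMap_eq_smul_one, ← Matrix.one_apply_eq (α := P) (0 : Fin 1)]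
      exact Submodule.smul_mem _ _ (apply_mem_coefficientSpan 1 0 0)
  add_mem' := by
    rintro x y ⟨n, u, hu, hx⟩ ⟨m, v, hv, hy⟩
    let e := finSumFinEquiv (m := n) (n := m)
    refine ⟨n + m, _, (hu.fromBlocks hv).submatrix e.symm, add_mem ?_ ?_⟩
    · refine Submodule.span_mono ?_ hx
      rintro _ ⟨⟨i, j⟩, rfl⟩
      exact ⟨(e (.inl i), e (.inl j)), by simp⟩
    · refine Submodule.span_mono ?_ hy
      rintro _ ⟨⟨i, j⟩, rfl⟩
      exact ⟨(e (.inr i), e (.inr j)), by simp⟩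
  mul_mem' := by
    rintro x y ⟨n, u, hu, hx⟩ ⟨m, v, hv, hy⟩
    let e := finProdFinEquiv (m := n) (n := m)
    refine ⟨n * m, _, (hu.tensor hv).submatrix e.symm, ?_⟩
    have h := Submodule.mul_mem_mul hx hy
    rw [coefficientSpan, coefficientSpan, Submodule.span_mul_span] at h
    refine Submodule.span_mono ?_ h
    rintro _ ⟨_, ⟨⟨i, j⟩, rfl⟩, _, ⟨⟨k, l⟩, rfl⟩, rfl⟩
    exact ⟨(e (i, k), e (j, l)), by simp [corepresentationTensor]⟩

end Corepresentation

/-! ### The model as a compact quantum group. -/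

namespace IsometryPol

theorem isUnitaryCorepresentation :
    IsUnitaryCorepresentation (!![A, B; z * B, z * A] : Matrix (Fin 2) (Fin 2) IsometryPol) where
  star_mul := by
    ext i j
    fin_cases i <;> fin_cases j <;>
    simp [Matrix.mul_apply, star_A, star_B, star_z, mul_assoc, A_mul_z, B_mul_z, z_mul_z_mul,
      B_mul_A, B_mul_B, mul_sub, z_mul_z, A_mul_z_mul, B_mul_z_mul]
  mul_star := by
    ext i j
    fin_cases i <;> fin_cases j <;>
    simp [Matrix.mul_apply, star_A, star_B, star_z, mul_assoc, A_mul_z, B_mul_z, z_mul_z_mul,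
      B_mul_A, B_mul_B, mul_sub, z_mul_z, A_mul_z_mul, B_mul_z_mul]
  comul i j := by
    have hA : Coalgebra.comul (R := ℂ) (z * A) = (z * A) ⊗ₜ[ℂ] (z * A) + (z * B) ⊗ₜ[ℂ] B :=
      comulAlg_z_mul_A
    have hB : Coalgebra.comul (R := ℂ) (z * B) = (z * A) ⊗ₜ[ℂ] (z * B) + (z * B) ⊗ₜ[ℂ] A :=
      comulAlg_z_mul_B
    fin_cases i <;> fin_cases j <;>
    simp [-Bialgebra.comul_mul, comul_A, comul_B, hA, hB, add_comm]

theorem coefficientSubalgebra_eq_top : coefficientSubalgebra IsometryPol = ⊤ := by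
  rw [eq_top_iff, ← adjoin_eq_top, Algebra.adjoin_le_iff]
  rintro _ (rfl | rfl)
  exacts [⟨2, _, isUnitaryCorepresentation, apply_mem_coefficientSpan _ 0 0⟩,
    ⟨2, _, isUnitaryCorepresentation, apply_mem_coefficientSpan _ 0 1⟩]

end IsometryPol

/-- The quantum isometry group of the dual of `ℤ₄`. -/
noncomputable abbrev isometryQuantumGroup : CompactQuantumGroup where
  Pol := IsometryPol
  comul_star x := map_star IsometryPol.comulHom x
  exists_corepresentation x := by
    have hx : x ∈ coefficientSubalgebra IsometryPol := by
      rw [IsometryPol.coefficientSubalgebra_eq_top]; trivial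
    obtain ⟨n, u, hu, hx⟩ := hx
    exact ⟨n, u, Unitary.mem_iff.2 ⟨hu.star_mul, hu.mul_star⟩, hu.comul, hx⟩

/-- The hypotheses are the coefficients, at `1` and at `g²`, of `α(g)²` and of `α(g)α(g⁻¹) = 1 =
α(g⁻¹)α(g)`. The proof shows that multiplication by `T` on either side exchanges `x` with `x*` and
`y` with `y*`. -/
theorem isotropicPair_of_relations {Q : Type*} [Ring Q] [StarRing Q] {x y : Q}
    (h1 : x * star y + star y * x = 0)
    (h2 : x * x + star y * star y = star x * star x + y * y)
    (h3 : x * y + star y * star x = 0) (h4 : x * star x + star y * y = 1)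
    (h5 : y * x + star x * star y = 0) (h6 : y * star y + star x * x = 1) :
    IsotropicPair x y ∧ star x = (x * x + y * y) * x ∧ star y = (x * x + y * y) * y := by
  obtain ⟨T, hT⟩ : ∃ T, T = x * x + star y * star y := ⟨_, rfl⟩
  have hT' : T = star x * star x + y * y := hT.trans h2
  -- The two sides of `h2` are adjoint to each other.
  have hs : star T = T := by
    rw [hT]; nth_rw 2 [h2]; simp
  have h1s : y * star x + star x * y = 0 := by
    have := congrArg star h1
    simpa using this
  -- Here `x²x* = x(1 - y*y)` and `y*²x* = -y*xy`; the remainder `-(xy* + y*x)y` vanishes by `h1`.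
  -- The next three are analogous, and the four after them are adjoints of these.
  have hTX : T * star x = x := by
    rw [hT]; linear_combination (norm := noncomm_ring) x * h4 + star y * h3 - h1 * y
  have hXT : star x * T = x := by
    rw [hT]; linear_combination (norm := noncomm_ring) h6 * x + h5 * star y - y * h1
  have hTY : T * star y = y := by
    rw [hT']; linear_combination (norm := noncomm_ring) y * h6 + star x * h5 - h1s * x
  have hYT : star y * T = y := by
    rw [hT']; linear_combination (norm := noncomm_ring) h4 * y + h3 * star x - x * h1s
  have hxT : x * T = star x := by simpa [hs] using congrArg star hTX
  have hTx : T * x = star x := by simpa [hs] using congrArg star hXT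
  have hTy : T * y = star y := by simpa [hs] using congrArg star hYT
  have hyT : y * T = star y := by simpa [hs] using congrArg star hTY
  have hTT : T * T = 1 := by
    calc T * T = T * T * (x * star x + star y * y) := by rw [h4, mul_one]
      _ = T * (T * x) * star x + T * (T * star y) * y := by noncomm_ring
      _ = 1 := by rw [hTx, hTX, hTY, hTy, h4]
  have hTxy : T = x * x + y * y := by
    have : star y * star y = y * y := by
      calc star y * star y = y * (T * star y) := by rw [← mul_assoc, hyT]
        _ = y * y := by rw [hTY]
    rw [hT, this]
  -- After inserting `T² = 1`, one has `yT = y*` and `y(xT) = yTx = y*x`, which leaves `h1` times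
  -- `T`.
  have hanti : x * y + y * x = 0 := by
    calc x * y + y * x = (x * (y * T) + y * (x * T)) * T := by
          linear_combination (norm := noncomm_ring) - (x * y + y * x) * hTT
      _ = (x * star y + star y * x) * T := by rw [hyT, hxT, ← hTx, ← mul_assoc, hyT]
      _ = 0 := by rw [h1, zero_mul]
  exact ⟨⟨hanti, hTxy ▸ hTT⟩, hTxy ▸ hTx.symm, hTxy ▸ hTy.symm⟩

/-! ### Coefficients of elements of `ℂΓ ⊗ Q` -/

section Coefficients

variable {Γ : Type} {Q : Type*} [Ring Q] [Algebra ℂ Q]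

variable (Q) in
/-- The coefficient at a group element of an element of `ℂΓ ⊗ Q`. -/
noncomputable def tensorCoeff (g : Γ) : MonoidAlgebra ℂ Γ ⊗[ℂ] Q →ₗ[ℂ] Q :=
  (TensorProduct.lid ℂ Q).toLinearMap ∘ₗ
    (Finsupp.lapply g ∘ₗ (MonoidAlgebra.coeffLinearEquiv ℂ).toLinearMap).rTensor Q

theorem tensorCoeff_tmul (g : Γ) (f : MonoidAlgebra ℂ Γ) (q : Q) :
    tensorCoeff Q g (f ⊗ₜ q) = f.coeff g • q := by
  simp [tensorCoeff]

theorem tensorCoeff_single_tmul [DecidableEq Γ] (g h : Γ) (q : Q) :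
    tensorCoeff Q g (MonoidAlgebra.single h 1 ⊗ₜ q) = if h = g then q else 0 := by
  rw [tensorCoeff_tmul, MonoidAlgebra.coeff_single, Finsupp.single_apply]
  split_ifs <;> simp

theorem sum_single_tmul_tensorCoeff [Fintype Γ] (x : MonoidAlgebra ℂ Γ ⊗[ℂ] Q) :
    ∑ g, MonoidAlgebra.single g (1 : ℂ) ⊗ₜ[ℂ] tensorCoeff Q g x = x := by
  classical
  induction x with
  | zero => simp
  | add x y hx hy => simp only [map_add, TensorProduct.tmul_add, Finset.sum_add_distrib, hx, hy]
  | tmul f q =>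
    simp only [tensorCoeff_tmul, ← TensorProduct.smul_tmul, ← TensorProduct.sum_tmul]
    congr 1
    ext h
    simp

theorem tensorCoeff_map {Q' : Type*} [Ring Q'] [Algebra ℂ Q'] (f : Q →ₗ[ℂ] Q') (g : Γ)
    (x : MonoidAlgebra ℂ Γ ⊗[ℂ] Q) :
    tensorCoeff Q' g (f.lTensor _ x) = f (tensorCoeff Q g x) := by
  induction x with
  | zero => simp
  | add x y hx hy => simp only [map_add, hx, hy]
  | tmul a q => simp [tensorCoeff_tmul]

variable [Group Γ] (S : Set Γ)

theorem diracOperator_single (g : Γ) (c : ℂ) :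
    diracOperator S (MonoidAlgebra.single g c) = MonoidAlgebra.single g (c * wordLength S g) := by
  simp [diracOperator]

theorem coeff_diracOperator (f : MonoidAlgebra ℂ Γ) (g : Γ) :
    (diracOperator S f).coeff g = wordLength S g * f.coeff g := by
  classical
  induction f using MonoidAlgebra.induction_linear with
  | zero => simp
  | add x y hx hy => simp [hx, hy, mul_add]
  | single h c =>
    rw [diracOperator_single]
    simp only [MonoidAlgebra.coeff_single, Finsupp.single_apply]
    split_ifs with hh
    · rw [hh, mul_comm]
    · simp

/-- The operator is diagonal in the group basis. Invariance of eigenspaces thereby becomes the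
vanishing of coefficients of the coaction. -/
theorem mem_eigenspace_diracOperator {μ : ℂ} {f : MonoidAlgebra ℂ Γ} :
    f ∈ Module.End.eigenspace (diracOperator S) μ ↔
      ∀ g, (wordLength S g : ℂ) ≠ μ → f.coeff g = 0 := by
  rw [Module.End.mem_eigenspace_iff]
  constructor
  · intro h g hg
    have h2 : (wordLength S g : ℂ) * f.coeff g = μ * f.coeff g := by
      rw [← coeff_diracOperator, h]; simp
    exact (mul_eq_mul_right_iff.1 h2).resolve_left hg
  · intro h
    ext g
    rw [coeff_diracOperator]
    by_cases hg : (wordLength S g : ℂ) = μ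
    · simp [hg]
    · simp [h g hg]

theorem single_mem_eigenspace_diracOperator (g : Γ) (c : ℂ) :
    MonoidAlgebra.single g c ∈ Module.End.eigenspace (diracOperator S) (wordLength S g) := by
  classical
  rw [mem_eigenspace_diracOperator]
  intro h hh
  rw [MonoidAlgebra.coeff_single, Finsupp.single_apply, if_neg]
  rintro rfl
  exact hh rfl

theorem tensorCoeff_eq_zero_of_mem_range {μ : ℂ} {x : MonoidAlgebra ℂ Γ ⊗[ℂ] Q}
    (hx : x ∈ LinearMap.range ((Module.End.eigenspace (diracOperator S) μ).subtype.rTensor Q))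
    {g : Γ} (hg : (wordLength S g : ℂ) ≠ μ) : tensorCoeff Q g x = 0 := by
  obtain ⟨y, rfl⟩ := hx
  induction y with
  | zero => simp
  | add x y hx hy => simp only [map_add, hx, hy, add_zero]
  | tmul f q =>
    rw [LinearMap.rTensor_tmul, tensorCoeff_tmul, Submodule.subtype_apply,
      (mem_eigenspace_diracOperator S).1 f.2 g hg, zero_smul]

theorem mem_range_of_tensorCoeff_eq_zero [Fintype Γ] {μ : ℂ} {x : MonoidAlgebra ℂ Γ ⊗[ℂ] Q}
    (hx : ∀ g, (wordLength S g : ℂ) ≠ μ → tensorCoeff Q g x = 0) :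
    x ∈ LinearMap.range ((Module.End.eigenspace (diracOperator S) μ).subtype.rTensor Q) := by
  rw [← sum_single_tmul_tensorCoeff x]
  refine Submodule.sum_mem _ fun g _ => ?_
  by_cases hg : (wordLength S g : ℂ) = μ
  · exact ⟨⟨_, hg ▸ single_mem_eigenspace_diracOperator S g 1⟩ ⊗ₜ tensorCoeff Q g x, by simp⟩
  · rw [hx g hg, TensorProduct.tmul_zero]
    exact zero_mem _

end Coefficients

/-! ### Word lengths -/

section WordLength

variable {Γ : Type} [Group Γ] {S : Set Γ}

theorem wordLength_le {g : Γ} (L : List Γ) (hL : ∀ h ∈ L, h ∈ S) (hg : L.prod = g) :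
    wordLength S g ≤ L.length := Nat.sInf_le ⟨L, rfl, hL, hg⟩

/-- The infimum of the empty set is `0` in `ℕ`, so a minimal word exists only if some word does; `L`
is that witness. -/
theorem exists_list_length_eq_wordLength {g : Γ} (L : List Γ) (hL : ∀ h ∈ L, h ∈ S)
    (hg : L.prod = g) :
    ∃ L : List Γ, L.length = wordLength S g ∧ (∀ h ∈ L, h ∈ S) ∧ L.prod = g :=
  Nat.sInf_mem (s := {r | ∃ L : List Γ, L.length = r ∧ (∀ h ∈ L, h ∈ S) ∧ L.prod = g})
    ⟨_, L, rfl, hL, hg⟩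

theorem wordLength_one : wordLength S (1 : Γ) = 0 :=
  Nat.le_zero.1 (wordLength_le [] (by simp) rfl)

theorem wordLength_eq_one {g : Γ} (hg : g ∈ S) (h1 : g ≠ 1) : wordLength S g = 1 := by
  obtain ⟨L, hL, -, hLg⟩ := exists_list_length_eq_wordLength (g := g) [g] (by simpa using hg)
    (by simp)
  have hle : wordLength S g ≤ 1 := wordLength_le [g] (by simpa using hg) (by simp)
  rcases Nat.le_one_iff_eq_zero_or_eq_one.1 hle with h | h
  · rw [h, List.length_eq_zero_iff] at hL
    subst hL
    exact absurd hLg.symm h1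
  · exact h

theorem wordLength_mul_eq_two {g h : Γ} (hg : g ∈ S) (hh : h ∈ S) (h1 : g * h ≠ 1)
    (h2 : g * h ∉ S) : wordLength S (g * h) = 2 := by
  have hmem : ∀ k ∈ [g, h], k ∈ S := by simp [hg, hh]
  obtain ⟨L, hL, hLS, hLg⟩ := exists_list_length_eq_wordLength (g := g * h) [g, h] hmem (by simp)
  have hle : wordLength S (g * h) ≤ 2 := wordLength_le [g, h] hmem (by simp)
  rcases L with - | ⟨a, - | ⟨b, L⟩⟩
  · exact absurd hLg.symm h1
  · simp only [List.prod_cons, List.prod_nil, mul_one] at hLg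
    exact absurd (hLg ▸ hLS a (by simp)) h2
  · simp only [List.length_cons] at hL
    omega

end WordLength

/-! ### The group with four elements -/

/-- The group `ℤ₄`, written multiplicatively. -/
abbrev CyclicFour : Type := Multiplicative (ZMod 4)

/-- The standard generators of `ℤ₄`. -/
abbrev cyclicFourGenerators : Set CyclicFour :=
  {Multiplicative.ofAdd 1, Multiplicative.ofAdd (-1)}

/-- The basis element of `ℂℤ₄` attached to a residue class. -/
noncomputable abbrev cyclicFourBasis (k : ZMod 4) : MonoidAlgebra ℂ CyclicFour :=
  MonoidAlgebra.single (Multiplicative.ofAdd k) 1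

theorem zmodFour_cases (k : ZMod 4) : k = 0 ∨ k = 1 ∨ k = -1 ∨ k = 2 := by
  revert k; decide

theorem cyclicFourBasis_mul (j k : ZMod 4) :
    cyclicFourBasis j * cyclicFourBasis k = cyclicFourBasis (j + k) := by
  rw [MonoidAlgebra.single_mul_single, mul_one]; rfl

theorem star_cyclicFourBasis (k : ZMod 4) : star (cyclicFourBasis k) = cyclicFourBasis (-k) := by
  rw [cyclicFourBasis, groupAlgebra_star_single, star_one]; rfl

theorem wordLength_zero : wordLength cyclicFourGenerators (Multiplicative.ofAdd 0) = 0 :=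
  wordLength_one

theorem wordLength_pos : wordLength cyclicFourGenerators (Multiplicative.ofAdd 1) = 1 :=
  wordLength_eq_one (by simp) (by decide)

theorem wordLength_neg : wordLength cyclicFourGenerators (Multiplicative.ofAdd (-1)) = 1 :=
  wordLength_eq_one (by simp) (by decide)

theorem wordLength_two : wordLength cyclicFourGenerators (Multiplicative.ofAdd 2) = 2 := by
  have h : (Multiplicative.ofAdd 2 : CyclicFour) =
    Multiplicative.ofAdd 1 * Multiplicative.ofAdd 1 := by decide
  rw [h]
  refine wordLength_mul_eq_two (by simp) (by simp) (by decide) ?_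
  rintro (h | h) <;> revert h <;> decide

theorem cyclicFour_linearMap_ext {M : Type*} [AddCommMonoid M] [Module ℂ M]
    {f g : MonoidAlgebra ℂ CyclicFour →ₗ[ℂ] M} (h0 : f 1 = g 1)
    (h1 : f (cyclicFourBasis 1) = g (cyclicFourBasis 1))
    (h2 : f (cyclicFourBasis (-1)) = g (cyclicFourBasis (-1)))
    (h3 : f (cyclicFourBasis 2) = g (cyclicFourBasis 2)) : f = g := by
  refine LinearMap.ext fun x => ?_
  induction x using MonoidAlgebra.induction_linear with
  | zero => simp
  | add x y hx hy => rw [map_add, map_add, hx, hy]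
  | single k c =>
    have h : MonoidAlgebra.single k c = c • cyclicFourBasis k.toAdd := by simp
    rw [h, map_smul, map_smul]
    congr 1
    rcases zmodFour_cases k.toAdd with h | h | h | h <;> rw [h]
    exacts [h0, h1, h2, h3]

section Power

variable {M : Type*} [Monoid M] {v : M} (hv : v ^ 4 = 1)

/-- The homomorphism from `ℤ₄` given by an element whose fourth power is `1`. -/
def cyclicFourLift : CyclicFour →* M where
  toFun a := v ^ a.toAdd.val
  map_one' := by simp
  map_mul' a b := by
    rw [toAdd_mul, ZMod.val_add, ← pow_eq_pow_mod _ hv, pow_add]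

theorem cyclicFourLift_apply (a : CyclicFour) : cyclicFourLift hv a = v ^ a.toAdd.val := rfl

end Power

theorem star_cyclicFourLift {R : Type*} [Monoid R] [StarMul R] {v : R} (hv : v ^ 4 = 1)
    (hs : star v = v ^ 3) (a : CyclicFour) :
    star (cyclicFourLift hv a) = cyclicFourLift hv a⁻¹ := by
  rw [cyclicFourLift_apply, cyclicFourLift_apply, star_pow, hs, ← pow_mul,
    pow_eq_pow_mod _ hv, pow_eq_pow_mod (Multiplicative.toAdd a⁻¹).val hv]
  -- What is left is `3a ≡ -a` modulo `4`.
  congr 1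
  revert a
  decide

section StarLift

variable {R : Type*} [Ring R] [Algebra ℂ R] [StarRing R] [StarModule ℂ R]

/-- A homomorphism from a group algebra is a `*`-homomorphism if it is so on the group. -/
noncomputable def groupAlgebraStarLift {Γ : Type*} [Group Γ] (φ : Γ →* R)
    (hφ : ∀ g, star (φ g) = φ g⁻¹) : MonoidAlgebra ℂ Γ →⋆ₐ[ℂ] R where
  __ := MonoidAlgebra.lift ℂ R Γ φ
  map_star' x := by
    change MonoidAlgebra.lift ℂ R Γ φ (star x) = star (MonoidAlgebra.lift ℂ R Γ φ x)
    induction x using MonoidAlgebra.induction_linear with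
    | zero => simp
    | add x y hx hy => rw [star_add, map_add, hx, hy, map_add, star_add]
    | single g c =>
      rw [groupAlgebra_star_single, MonoidAlgebra.lift_single, MonoidAlgebra.lift_single,
        star_smul, hφ]

theorem groupAlgebraStarLift_single {Γ : Type*} [Group Γ] (φ : Γ →* R)
    (hφ : ∀ g, star (φ g) = φ g⁻¹) (g : Γ) :
    groupAlgebraStarLift φ hφ (MonoidAlgebra.single g 1) = φ g :=
  (MonoidAlgebra.lift_single φ g 1).trans (one_smul _ _)

end StarLift

/-! ### The universal action -/

namespace IsometryPol

/-- The image of the generator of `ℤ₄` under the universal action. -/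
noncomputable def actionGenerator : MonoidAlgebra ℂ CyclicFour ⊗[ℂ] IsometryPol :=
  cyclicFourBasis 1 ⊗ₜ A + cyclicFourBasis (-1) ⊗ₜ (z * B)

/-- The coefficient at `1` is `z(AB + BA) = 0`, and the one at `g²` is `A² + B² = z`. Hence the
fourth power is `1`, and the cube, which is the inverse, turns out to be the adjoint. -/
theorem actionGenerator_sq : actionGenerator ^ 2 = cyclicFourBasis 2 ⊗ₜ z := by
  have h1 : (1 + 1 : ZMod 4) = 2 := by decide
  have h2 : (-1 + -1 : ZMod 4) = 2 := by decide
  simp only [actionGenerator, sq, add_mul, mul_add, Algebra.TensorProduct.tmul_mul_tmul,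
    cyclicFourBasis_mul, add_neg_cancel, neg_add_cancel, h1, h2, mul_assoc, A_mul_z_mul,
    B_mul_z_mul, z_mul_z_mul, B_mul_A, mul_neg, B_mul_B, TensorProduct.tmul_neg,
    TensorProduct.tmul_sub]
  abel

theorem actionGenerator_pow_three :
    actionGenerator ^ 3 = cyclicFourBasis 1 ⊗ₜ B + cyclicFourBasis (-1) ⊗ₜ (z * A) := by
  have h1 : (2 + 1 : ZMod 4) = -1 := by decide
  have h2 : (2 + -1 : ZMod 4) = 1 := by decide
  rw [pow_succ, actionGenerator_sq, actionGenerator, mul_add,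
    Algebra.TensorProduct.tmul_mul_tmul, Algebra.TensorProduct.tmul_mul_tmul, cyclicFourBasis_mul,
    cyclicFourBasis_mul, h1, h2, z_mul_z_mul, add_comm]

theorem actionGenerator_pow_four : actionGenerator ^ 4 = 1 := by
  have h : (2 + 2 : ZMod 4) = 0 := by decide
  rw [pow_mul actionGenerator 2 2, actionGenerator_sq, sq, Algebra.TensorProduct.tmul_mul_tmul,
    cyclicFourBasis_mul, z_mul_z, h]
  rfl

theorem star_actionGenerator : star actionGenerator = actionGenerator ^ 3 := by
  rw [actionGenerator_pow_three, actionGenerator, star_add, TensorProduct.star_tmul,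
    TensorProduct.star_tmul, star_cyclicFourBasis, star_cyclicFourBasis, star_mul, star_z, star_A,
    star_B, mul_assoc, B_mul_z, z_mul_z_mul, neg_neg, add_comm]

/-- The universal action. -/
noncomputable def action :
    MonoidAlgebra ℂ CyclicFour →⋆ₐ[ℂ] MonoidAlgebra ℂ CyclicFour ⊗[ℂ] IsometryPol :=
  groupAlgebraStarLift (cyclicFourLift actionGenerator_pow_four)
    (star_cyclicFourLift actionGenerator_pow_four star_actionGenerator)

theorem action_pos :
    action (cyclicFourBasis 1) = cyclicFourBasis 1 ⊗ₜ A + cyclicFourBasis (-1) ⊗ₜ (z * B) :=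
  (groupAlgebraStarLift_single _ _ _).trans (pow_one _)

theorem action_two : action (cyclicFourBasis 2) = cyclicFourBasis 2 ⊗ₜ z :=
  (groupAlgebraStarLift_single _ _ _).trans actionGenerator_sq

theorem action_neg :
    action (cyclicFourBasis (-1)) = cyclicFourBasis 1 ⊗ₜ B + cyclicFourBasis (-1) ⊗ₜ (z * A) :=
  (groupAlgebraStarLift_single _ _ _).trans actionGenerator_pow_three

theorem action_coassoc (x : MonoidAlgebra ℂ CyclicFour) :
    TensorProduct.assoc ℂ _ _ _ (action.toAlgHom.toLinearMap.rTensor IsometryPol (action x)) =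
      (Coalgebra.comul (R := ℂ) (A := IsometryPol)).lTensor (MonoidAlgebra ℂ CyclicFour)
        (action x) := by
  have hA : Coalgebra.comul (R := ℂ) (z * A) = (z * A) ⊗ₜ[ℂ] (z * A) + (z * B) ⊗ₜ[ℂ] B :=
    comulAlg_z_mul_A
  have hB : Coalgebra.comul (R := ℂ) (z * B) = (z * A) ⊗ₜ[ℂ] (z * B) + (z * B) ⊗ₜ[ℂ] A :=
    comulAlg_z_mul_B
  have h (y : MonoidAlgebra ℂ CyclicFour) : action.toAlgHom.toLinearMap y = action y := rfl
  suffices H : (TensorProduct.assoc ℂ (MonoidAlgebra ℂ CyclicFour) IsometryPol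
      IsometryPol).toLinearMap ∘ₗ (action.toAlgHom.toLinearMap.rTensor IsometryPol) ∘ₗ
        action.toAlgHom.toLinearMap = (Coalgebra.comul (R := ℂ) (A := IsometryPol)).lTensor
          (MonoidAlgebra ℂ CyclicFour) ∘ₗ action.toAlgHom.toLinearMap from LinearMap.congr_fun H x
  apply cyclicFour_linearMap_ext
  · simp only [LinearMap.comp_apply, h, map_one, Algebra.TensorProduct.one_def,
      LinearMap.rTensor_tmul, LinearMap.lTensor_tmul, Bialgebra.comul_one, LinearEquiv.coe_coe,
      TensorProduct.assoc_tmul]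
  · simp only [LinearMap.comp_apply, h, action_pos, map_add, action_neg, LinearMap.rTensor_tmul,
      LinearMap.lTensor_tmul, comul_A, hB, TensorProduct.add_tmul, TensorProduct.tmul_add,
      LinearEquiv.coe_coe, TensorProduct.assoc_tmul]
    abel
  · simp only [LinearMap.comp_apply, h, action_pos, map_add, action_neg, LinearMap.rTensor_tmul,
      LinearMap.lTensor_tmul, comul_B, hA, TensorProduct.add_tmul, TensorProduct.tmul_add,
      LinearEquiv.coe_coe, TensorProduct.assoc_tmul]
    abel
  · simp only [LinearMap.comp_apply, h, action_two, LinearMap.rTensor_tmul,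
      LinearMap.lTensor_tmul, comul_z, LinearEquiv.coe_coe, TensorProduct.assoc_tmul]

theorem action_counit (x : MonoidAlgebra ℂ CyclicFour) :
    TensorProduct.rid ℂ _ ((Coalgebra.counit (R := ℂ) (A := IsometryPol)).lTensor
      (MonoidAlgebra ℂ CyclicFour) (action x)) = x := by
  suffices H : (TensorProduct.rid ℂ (MonoidAlgebra ℂ CyclicFour)).toLinearMap ∘ₗ
      (Coalgebra.counit (R := ℂ) (A := IsometryPol)).lTensor (MonoidAlgebra ℂ CyclicFour) ∘ₗ
        action.toAlgHom.toLinearMap = LinearMap.id from LinearMap.congr_fun H x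
  apply cyclicFour_linearMap_ext <;>
  simp [Algebra.TensorProduct.one_def, action_pos, action_neg, action_two, counit_A, counit_B,
    counit_z, -MonoidAlgebra.smul_single]

theorem tensorCoeff_action (g h : CyclicFour) (hgh : wordLength cyclicFourGenerators g ≠
    wordLength cyclicFourGenerators h) :
    tensorCoeff IsometryPol g (action (MonoidAlgebra.single h 1)) = 0 := by
  have hne {j k : ZMod 4} (hjk : j ≠ k) (q : IsometryPol) :
      tensorCoeff IsometryPol (Multiplicative.ofAdd k) (cyclicFourBasis j ⊗ₜ q) = 0 := by
    rw [tensorCoeff_single_tmul, if_neg]; exact hjk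
  obtain ⟨j, rfl⟩ := Multiplicative.ofAdd.surjective g
  obtain ⟨k, rfl⟩ := Multiplicative.ofAdd.surjective h
  change tensorCoeff IsometryPol _ (action (cyclicFourBasis k)) = 0
  have h1 : action (cyclicFourBasis 0) = cyclicFourBasis 0 ⊗ₜ 1 := map_one action
  -- Among the sixteen pairs, those of equal length contradict `hgh`; in the others the support of
  -- the image misses the first index.
  rcases zmodFour_cases k with rfl | rfl | rfl | rfl <;>
  rcases zmodFour_cases j with rfl | rfl | rfl | rfl <;>
  simp only [wordLength_zero, wordLength_pos, wordLength_neg, wordLength_two, ne_eq,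
    not_true_eq_false] at hgh <;>
  simp only [h1, action_pos, action_neg, action_two, map_add] <;>
  repeat rw [hne (by decide)]
  all_goals simp

theorem action_mem_range {μ : ℂ} {x : MonoidAlgebra ℂ CyclicFour}
    (hx : x ∈ Module.End.eigenspace (diracOperator cyclicFourGenerators) μ) :
    action x ∈ LinearMap.range ((Module.End.eigenspace (diracOperator cyclicFourGenerators)
      μ).subtype.rTensor IsometryPol) := by
  refine mem_range_of_tensorCoeff_eq_zero _ fun g hg => ?_
  have hsum : x = ∑ h, x.coeff h • MonoidAlgebra.single h (1 : ℂ) := by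
    ext h; simp
  rw [hsum, map_sum, map_sum]
  refine Finset.sum_eq_zero fun h _ => ?_
  rw [map_smul, map_smul]
  by_cases hh : (wordLength cyclicFourGenerators h : ℂ) = μ
  · rw [tensorCoeff_action g h, smul_zero]
    rintro h2
    exact hg (by rw [h2, hh])
  · rw [(mem_eigenspace_diracOperator _).1 hx h hh, zero_smul]

theorem action_trace (x : MonoidAlgebra ℂ CyclicFour) :
    tensorCoeff IsometryPol 1 (action x) = x.coeff 1 • 1 := by
  suffices H : tensorCoeff IsometryPol 1 ∘ₗ action.toAlgHom.toLinearMap =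
      (LinearMap.toSpanSingleton ℂ IsometryPol 1) ∘ₗ Finsupp.lapply 1 ∘ₗ
        (MonoidAlgebra.coeffLinearEquiv ℂ).toLinearMap from LinearMap.congr_fun H x
  have h1 (k : ZMod 4) (hk : k ≠ 0) : (cyclicFourBasis k).coeff 1 = 0 := by
    rw [MonoidAlgebra.coeff_single, Finsupp.single_apply, if_neg]; exact hk
  have h2 : (1 : MonoidAlgebra ℂ CyclicFour).coeff 1 = 1 := by
    simp [MonoidAlgebra.one_def]
  apply cyclicFour_linearMap_ext
  · simp [Algebra.TensorProduct.one_def, tensorCoeff_tmul, h2]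
  · simp [-MonoidAlgebra.coeff_single, action_pos, tensorCoeff_tmul,
      h1 1 (by decide), h1 (-1) (by decide)]
  · simp [-MonoidAlgebra.coeff_single, action_neg, tensorCoeff_tmul,
      h1 1 (by decide), h1 (-1) (by decide)]
  · simp [-MonoidAlgebra.coeff_single, action_two, tensorCoeff_tmul, h1 2 (by decide)]

end IsometryPol

/-- The universal isometric action on the dual of `ℤ₄`. -/
noncomputable def isometryAction :
    IsometricAction CyclicFour cyclicFourGenerators isometryQuantumGroup where
  α := IsometryPol.action
  coassoc := IsometryPol.action_coassoc
  counit := IsometryPol.action_counit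
  eigenspace _ _ hx := IsometryPol.action_mem_range hx
  trace := IsometryPol.action_trace

/-! ### Universality -/

namespace CompactQuantumGroup

theorem IsHopfMorphism.id (G : CompactQuantumGroup) :
    IsHopfMorphism (StarAlgHom.id ℂ G.Pol) :=
  ⟨fun x => by
    change Coalgebra.comul (R := ℂ) x =
      TensorProduct.map LinearMap.id LinearMap.id (Coalgebra.comul (R := ℂ) x)
    rw [TensorProduct.map_id]; rfl, fun _ => rfl⟩

theorem IsHopfMorphism.comp {G H K : CompactQuantumGroup} {f : G.Pol →⋆ₐ[ℂ] H.Pol}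
    {g : H.Pol →⋆ₐ[ℂ] K.Pol} (hg : IsHopfMorphism g) (hf : IsHopfMorphism f) :
    IsHopfMorphism (g.comp f) :=
  ⟨fun x => by
    change Coalgebra.comul (R := ℂ) (g (f x)) = TensorProduct.map
      (g.toAlgHom.toLinearMap ∘ₗ f.toAlgHom.toLinearMap)
      (g.toAlgHom.toLinearMap ∘ₗ f.toAlgHom.toLinearMap) (Coalgebra.comul (R := ℂ) x)
    rw [hg.1, hf.1, TensorProduct.map_comp, LinearMap.comp_apply],
  fun x => (hg.2 (f x)).trans (hf.2 x)⟩

end CompactQuantumGroup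

/-- The usual uniqueness of universal objects: both composites are the identity by the uniqueness
clause. Recording that coefficients correspond later identifies the images of `A` and `B`. -/
theorem IsometricAction.IsQuantumIsometryGroup.exists_equiv {Γ : Type} [Group Γ] {S : Set Γ}
    {G H : CompactQuantumGroup} {a : IsometricAction Γ S G} {b : IsometricAction Γ S H}
    (ha : a.IsQuantumIsometryGroup) (hb : b.IsQuantumIsometryGroup) :
    ∃ e : G.Pol ≃⋆ₐ[ℂ] H.Pol, ∀ (g : Γ) (x : MonoidAlgebra ℂ Γ),
      e (tensorCoeff G.Pol g (a.α x)) = tensorCoeff H.Pol g (b.α x) := by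
  obtain ⟨f, ⟨hf, hf'⟩, -⟩ := ha H b
  obtain ⟨g, ⟨hg, hg'⟩, -⟩ := hb G a
  have hgf : g.comp f = StarAlgHom.id ℂ G.Pol := by
    refine (ha G a).unique ⟨hg.comp hf, fun x => ?_⟩
      ⟨CompactQuantumGroup.IsHopfMorphism.id G, fun x => ?_⟩
    · change ((g.toAlgHom.toLinearMap ∘ₗ f.toAlgHom.toLinearMap).lTensor _) (a.α x) = _
      rw [LinearMap.lTensor_comp_apply, hf', hg']
    · exact LinearMap.congr_fun (LinearMap.lTensor_id _ _) _
  have hfg : f.comp g = StarAlgHom.id ℂ H.Pol := by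
    refine (hb H b).unique ⟨hf.comp hg, fun x => ?_⟩
      ⟨CompactQuantumGroup.IsHopfMorphism.id H, fun x => ?_⟩
    · change ((f.toAlgHom.toLinearMap ∘ₗ g.toAlgHom.toLinearMap).lTensor _) (b.α x) = _
      rw [LinearMap.lTensor_comp_apply, hg', hf']
    · exact LinearMap.congr_fun (LinearMap.lTensor_id _ _) _
  refine ⟨StarAlgEquiv.ofStarAlgHom f g hgf hfg, fun h x => ?_⟩
  rw [← hf', tensorCoeff_map]
  rfl

/-! ### Form, relations and coproduct of an arbitrary isometric action. -/

namespace IsometricAction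

variable {H : CompactQuantumGroup} (b : IsometricAction CyclicFour cyclicFourGenerators H)

theorem tensorCoeff_eq_zero {j k : ZMod 4}
    (hjk : wordLength cyclicFourGenerators (Multiplicative.ofAdd j) ≠
      wordLength cyclicFourGenerators (Multiplicative.ofAdd k)) :
    tensorCoeff H.Pol (Multiplicative.ofAdd j) (b.α (cyclicFourBasis k)) = 0 :=
  tensorCoeff_eq_zero_of_mem_range _
    (b.eigenspace _ _ (single_mem_eigenspace_diracOperator _ _ 1)) (by exact_mod_cast hjk)

theorem exists_form : ∃ x y : H.Pol,
    b.α (cyclicFourBasis 1) = cyclicFourBasis 1 ⊗ₜ x + cyclicFourBasis (-1) ⊗ₜ star y ∧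
    b.α (cyclicFourBasis (-1)) = cyclicFourBasis 1 ⊗ₜ y + cyclicFourBasis (-1) ⊗ₜ star x := by
  have h : b.α (cyclicFourBasis 1) =
      cyclicFourBasis 1 ⊗ₜ tensorCoeff H.Pol (Multiplicative.ofAdd 1) (b.α (cyclicFourBasis 1)) +
      cyclicFourBasis (-1) ⊗ₜ
        tensorCoeff H.Pol (Multiplicative.ofAdd (-1)) (b.α (cyclicFourBasis 1)) := by
    have h0 := b.tensorCoeff_eq_zero (j := 0) (k := 1)
      (by rw [wordLength_zero, wordLength_pos]; decide)
    have h2 := b.tensorCoeff_eq_zero (j := 2) (k := 1)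
      (by rw [wordLength_two, wordLength_pos]; decide)
    have hu : (Finset.univ : Finset CyclicFour) = {Multiplicative.ofAdd 0, Multiplicative.ofAdd 2,
        Multiplicative.ofAdd 1, Multiplicative.ofAdd (-1)} := by decide
    conv_lhs => rw [← sum_single_tmul_tensorCoeff (b.α (cyclicFourBasis 1)), hu]
    rw [Finset.sum_insert (by decide), Finset.sum_insert (by decide),
      Finset.sum_pair (by decide), h0, h2, TensorProduct.tmul_zero, TensorProduct.tmul_zero,
      zero_add, zero_add]
  refine ⟨_, star (tensorCoeff H.Pol (Multiplicative.ofAdd (-1)) (b.α (cyclicFourBasis 1))),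
    h.trans (by rw [star_star]), ?_⟩
  have hs : cyclicFourBasis (-1) = star (cyclicFourBasis 1) := (star_cyclicFourBasis 1).symm
  conv_lhs => rw [hs, map_star, h]
  rw [star_add, TensorProduct.star_tmul, TensorProduct.star_tmul, star_cyclicFourBasis,
    star_cyclicFourBasis, neg_neg, add_comm]

variable {b} {x y : H.Pol}
  (hpos : b.α (cyclicFourBasis 1) = cyclicFourBasis 1 ⊗ₜ x + cyclicFourBasis (-1) ⊗ₜ star y)
  (hneg : b.α (cyclicFourBasis (-1)) = cyclicFourBasis 1 ⊗ₜ y + cyclicFourBasis (-1) ⊗ₜ star x)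

theorem tensorCoeff_same (k : ZMod 4) {Q : Type*} [Ring Q] [Algebra ℂ Q] (q : Q) :
    tensorCoeff Q (Multiplicative.ofAdd k) (cyclicFourBasis k ⊗ₜ q) = q := by
  rw [tensorCoeff_single_tmul, if_pos rfl]

theorem tensorCoeff_ne {j k : ZMod 4} (hjk : j ≠ k) {Q : Type*} [Ring Q] [Algebra ℂ Q] (q : Q) :
    tensorCoeff Q (Multiplicative.ofAdd k) (cyclicFourBasis j ⊗ₜ q) = 0 := by
  rw [tensorCoeff_single_tmul, if_neg]; exact hjk

theorem basis_combination_mul {Q : Type*} [Ring Q] [Algebra ℂ Q] (p q r s : Q) :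
    (cyclicFourBasis 1 ⊗ₜ[ℂ] p + cyclicFourBasis (-1) ⊗ₜ[ℂ] q) *
      (cyclicFourBasis 1 ⊗ₜ[ℂ] r + cyclicFourBasis (-1) ⊗ₜ[ℂ] s) =
    cyclicFourBasis 2 ⊗ₜ (p * r + q * s) + cyclicFourBasis 0 ⊗ₜ (p * s + q * r) := by
  have h1 : (1 + 1 : ZMod 4) = 2 := by decide
  have h2 : (-1 + -1 : ZMod 4) = 2 := by decide
  simp only [add_mul, mul_add, Algebra.TensorProduct.tmul_mul_tmul, cyclicFourBasis_mul,
    add_neg_cancel, neg_add_cancel, h1, h2, TensorProduct.tmul_add]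
  abel

include hpos hneg

theorem relations : IsotropicPair x y ∧ star x = (x * x + y * y) * x ∧
    star y = (x * x + y * y) * y := by
  have e1 : cyclicFourBasis 1 * cyclicFourBasis 1 = cyclicFourBasis 2 := by
    rw [cyclicFourBasis_mul]; congr 1
  have e2 : cyclicFourBasis (-1) * cyclicFourBasis (-1) = cyclicFourBasis 2 := by
    rw [cyclicFourBasis_mul]; congr 1
  have e3 : cyclicFourBasis 1 * cyclicFourBasis (-1) = 1 := by rw [cyclicFourBasis_mul]; rfl
  have e4 : cyclicFourBasis (-1) * cyclicFourBasis 1 = 1 := by rw [cyclicFourBasis_mul]; rfl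
  have e5 : (1 : MonoidAlgebra ℂ CyclicFour ⊗[ℂ] H.Pol) = cyclicFourBasis 0 ⊗ₜ 1 := rfl
  have a1 := congrArg b.α e1
  have a2 := congrArg b.α e2
  have a3 := congrArg b.α e3
  have a4 := congrArg b.α e4
  rw [map_mul, hpos, basis_combination_mul] at a1
  rw [map_mul, hneg, basis_combination_mul] at a2
  rw [map_mul, hpos, hneg, basis_combination_mul, map_one, e5] at a3 a4
  have n1 : (2 : ZMod 4) ≠ 0 := by decide
  have n2 : (0 : ZMod 4) ≠ 2 := by decide
  have c0 {u v : MonoidAlgebra ℂ CyclicFour ⊗[ℂ] H.Pol} (h : u = v) :=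
    congrArg (tensorCoeff H.Pol (Multiplicative.ofAdd (0 : ZMod 4))) h
  have c2 {u v : MonoidAlgebra ℂ CyclicFour ⊗[ℂ] H.Pol} (h : u = v) :=
    congrArg (tensorCoeff H.Pol (Multiplicative.ofAdd (2 : ZMod 4))) h
  have r0 := c0 a1
  have r1 := c2 (a1.trans a2.symm)
  have r2 := c2 a3
  have r3 := c0 a3
  have r4 := c2 a4
  have r5 := c0 a4
  -- `1` and `g²` have different lengths, so `α(g²)` has no component at `1`; this supplies the
  -- anticommutation.
  rw [b.tensorCoeff_eq_zero (j := 0) (k := 2)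
    (by rw [wordLength_zero, wordLength_two]; decide)] at r0
  simp only [map_add, tensorCoeff_same, tensorCoeff_ne n1, tensorCoeff_ne n2, add_zero, zero_add]
    at r0 r1 r2 r3 r4 r5
  exact isotropicPair_of_relations r0 (r1.trans (add_comm _ _)) r2 r3 r4 r5

/-- Compare the coefficients at `g` in the coassociativity of the action applied to `g`. -/
theorem comul_fst : Coalgebra.comul (R := ℂ) x = x ⊗ₜ[ℂ] x + y ⊗ₜ[ℂ] star y := by
  have h := congrArg (tensorCoeff (H.Pol ⊗[ℂ] H.Pol) (Multiplicative.ofAdd (1 : ZMod 4)))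
    (b.coassoc (cyclicFourBasis 1))
  have h' (u : MonoidAlgebra ℂ CyclicFour) : b.α.toAlgHom.toLinearMap u = b.α u := rfl
  have n : (-1 : ZMod 4) ≠ 1 := by decide
  simp only [hpos, hneg, map_add, LinearMap.rTensor_tmul, LinearMap.lTensor_tmul, h',
    TensorProduct.add_tmul, TensorProduct.assoc_tmul, tensorCoeff_same, tensorCoeff_ne n,
    add_zero] at h
  exact h.symm

theorem comul_snd : Coalgebra.comul (R := ℂ) y = x ⊗ₜ[ℂ] y + y ⊗ₜ[ℂ] star x := by
  have h := congrArg (tensorCoeff (H.Pol ⊗[ℂ] H.Pol) (Multiplicative.ofAdd (1 : ZMod 4)))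
    (b.coassoc (cyclicFourBasis (-1)))
  have h' (u : MonoidAlgebra ℂ CyclicFour) : b.α.toAlgHom.toLinearMap u = b.α u := rfl
  have n : (-1 : ZMod 4) ≠ 1 := by decide
  simp only [hpos, hneg, map_add, LinearMap.rTensor_tmul, LinearMap.lTensor_tmul, h',
    TensorProduct.add_tmul, TensorProduct.assoc_tmul, tensorCoeff_same, tensorCoeff_ne n,
    add_zero] at h
  exact h.symm

omit hneg in
theorem counit_fst : Coalgebra.counit (R := ℂ) x = 1 := by
  have h := congrArg (fun f => f.coeff (Multiplicative.ofAdd (1 : ZMod 4)))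
    (b.counit (cyclicFourBasis 1))
  have n : (Multiplicative.ofAdd 1 : CyclicFour)⁻¹ ≠ Multiplicative.ofAdd 1 := by decide
  simpa [hpos, Finsupp.single_apply, n] using h

omit hpos in
theorem counit_snd : Coalgebra.counit (R := ℂ) y = 0 := by
  have h := congrArg (fun f => f.coeff (Multiplicative.ofAdd (1 : ZMod 4)))
    (b.counit (cyclicFourBasis (-1)))
  have n : (Multiplicative.ofAdd 1 : CyclicFour)⁻¹ ≠ Multiplicative.ofAdd 1 := by decide
  simpa [hneg, Finsupp.single_apply, n] using h

end IsometricAction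

/-! ### Comparison of the model with an arbitrary isometric action. -/

namespace IsometricAction

variable {H : CompactQuantumGroup} {b : IsometricAction CyclicFour cyclicFourGenerators H}
  {x y : H.Pol}

theorem isHopfMorphism_starLift
    (hpos : b.α (cyclicFourBasis 1) = cyclicFourBasis 1 ⊗ₜ x + cyclicFourBasis (-1) ⊗ₜ star y)
    (hneg : b.α (cyclicFourBasis (-1)) = cyclicFourBasis 1 ⊗ₜ y + cyclicFourBasis (-1) ⊗ₜ star x)
    {f : IsometryPol →⋆ₐ[ℂ] H.Pol} (hA : f IsometryPol.A = x) (hB : f IsometryPol.B = y) :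
    CompactQuantumGroup.IsHopfMorphism (G := isometryQuantumGroup) f := by
  have hA' : f (IsometryPol.z * IsometryPol.A) = star x := by
    rw [← IsometryPol.star_A, map_star, hA]
  have hB' : f (IsometryPol.z * IsometryPol.B) = star y := by
    rw [← IsometryPol.star_B, map_star, hB]
  have hf (u : IsometryPol) : f.toAlgHom u = f u := rfl
  constructor
  · have h : (Bialgebra.comulAlgHom ℂ H.Pol).comp f.toAlgHom =
        (Algebra.TensorProduct.map f.toAlgHom f.toAlgHom).comp
          (Bialgebra.comulAlgHom ℂ IsometryPol) := by
      apply IsometryPol.algHom_ext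
      · rw [AlgHom.comp_apply, AlgHom.comp_apply, Bialgebra.comulAlgHom_apply,
          Bialgebra.comulAlgHom_apply, IsometryPol.comul_A, hf, hA, comul_fst hpos hneg, map_add,
          Algebra.TensorProduct.map_tmul, Algebra.TensorProduct.map_tmul, hf, hf, hf, hA, hB, hB']
      · rw [AlgHom.comp_apply, AlgHom.comp_apply, Bialgebra.comulAlgHom_apply,
          Bialgebra.comulAlgHom_apply, IsometryPol.comul_B, hf, hB, comul_snd hpos hneg, map_add,
          Algebra.TensorProduct.map_tmul, Algebra.TensorProduct.map_tmul, hf, hf, hf, hA, hB, hA']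
    exact fun u => AlgHom.congr_fun h u
  · have h : (Bialgebra.counitAlgHom ℂ H.Pol).comp f.toAlgHom =
        Bialgebra.counitAlgHom ℂ IsometryPol := by
      apply IsometryPol.algHom_ext
      · rw [AlgHom.comp_apply, Bialgebra.counitAlgHom_apply, Bialgebra.counitAlgHom_apply, hf, hA,
          counit_fst hpos, IsometryPol.counit_A]
      · rw [AlgHom.comp_apply, Bialgebra.counitAlgHom_apply, Bialgebra.counitAlgHom_apply, hf, hB,
          counit_snd hneg, IsometryPol.counit_B]
    exact fun u => AlgHom.congr_fun h u

theorem lTensor_action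
    (hpos : b.α (cyclicFourBasis 1) = cyclicFourBasis 1 ⊗ₜ x + cyclicFourBasis (-1) ⊗ₜ star y)
    {f : IsometryPol →⋆ₐ[ℂ] H.Pol} (hA : f IsometryPol.A = x) (hB : f IsometryPol.B = y)
    (u : MonoidAlgebra ℂ CyclicFour) :
    f.toAlgHom.toLinearMap.lTensor (MonoidAlgebra ℂ CyclicFour) (IsometryPol.action u) =
      b.α u := by
  have hB' : f (IsometryPol.z * IsometryPol.B) = star y := by
    rw [← IsometryPol.star_B, map_star, hB]
  have hf (u : IsometryPol) : f.toAlgHom u = f u := rfl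
  have h : (Algebra.TensorProduct.map (.id ℂ (MonoidAlgebra ℂ CyclicFour)) f.toAlgHom).comp
      IsometryPol.action.toAlgHom = b.α.toAlgHom := by
    have key : Algebra.TensorProduct.map (.id ℂ (MonoidAlgebra ℂ CyclicFour)) f.toAlgHom
        (IsometryPol.action (cyclicFourBasis 1)) = b.α (cyclicFourBasis 1) := by
      rw [IsometryPol.action_pos, hpos, map_add, Algebra.TensorProduct.map_tmul,
        Algebra.TensorProduct.map_tmul, hf, hf, hA, hB', AlgHom.id_apply, AlgHom.id_apply]
    -- Every group element is a power of `g`, so agreement at `g`, which is `key`, suffices.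
    refine MonoidAlgebra.algHom_ext (fun (k : CyclicFour) => ?_) (Subsingleton.elim _ _)
    have hk : (MonoidAlgebra.single k 1 : MonoidAlgebra ℂ CyclicFour) =
        cyclicFourBasis 1 ^ k.toAdd.val := by
      have : k = Multiplicative.ofAdd (1 : ZMod 4) ^ k.toAdd.val := by revert k; decide
      conv_lhs => rw [this]
      rw [MonoidAlgebra.single_pow, one_pow]
    rw [AlgHom.comp_apply, hk, map_pow, map_pow, map_pow]
    exact congrArg (fun t : MonoidAlgebra ℂ CyclicFour ⊗[ℂ] H.Pol => t ^ k.toAdd.val) key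
  exact AlgHom.congr_fun h u

end IsometricAction

/-- Existence is the presentation applied to the coefficients `x`, `y`. For uniqueness, an
intertwining morphism must send `A` and `B` to the coefficients at `g` of the images of `g` and
`g⁻¹`, and these two elements generate. -/
theorem isometryAction_isQuantumIsometryGroup : isometryAction.IsQuantumIsometryGroup := by
  intro H b
  obtain ⟨x, y, hpos, hneg⟩ := b.exists_form
  obtain ⟨hxy, hx, hy⟩ := IsometricAction.relations hpos hneg
  have hA : IsometryPol.starLift hxy hx hy IsometryPol.A = x := IsometryPol.lift_A hxy
  have hB : IsometryPol.starLift hxy hx hy IsometryPol.B = y := IsometryPol.lift_B hxy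
  refine ⟨IsometryPol.starLift hxy hx hy,
    ⟨IsometricAction.isHopfMorphism_starLift hpos hneg hA hB,
      IsometricAction.lTensor_action hpos hA hB⟩, ?_⟩
  rintro g ⟨-, hg⟩
  have n : (-1 : ZMod 4) ≠ 1 := by decide
  have hgA : g IsometryPol.A = x := by
    have h := congrArg (tensorCoeff H.Pol (Multiplicative.ofAdd (1 : ZMod 4)))
      (hg (cyclicFourBasis 1))
    rw [tensorCoeff_map, hpos, map_add, IsometricAction.tensorCoeff_same,
      IsometricAction.tensorCoeff_ne n, add_zero] at h
    rw [← h]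
    change g _ = g (tensorCoeff IsometryPol _ (IsometryPol.action _))
    rw [IsometryPol.action_pos, map_add, IsometricAction.tensorCoeff_same,
      IsometricAction.tensorCoeff_ne n, add_zero]
  have hgB : g IsometryPol.B = y := by
    have h := congrArg (tensorCoeff H.Pol (Multiplicative.ofAdd (1 : ZMod 4)))
      (hg (cyclicFourBasis (-1)))
    rw [tensorCoeff_map, hneg, map_add, IsometricAction.tensorCoeff_same,
      IsometricAction.tensorCoeff_ne n, add_zero] at h
    rw [← h]
    change g _ = g (tensorCoeff IsometryPol _ (IsometryPol.action _))
    rw [IsometryPol.action_neg, map_add, IsometricAction.tensorCoeff_same,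
      IsometricAction.tensorCoeff_ne n, add_zero]
  have h : g.toAlgHom = (IsometryPol.starLift hxy hx hy).toAlgHom :=
    IsometryPol.algHom_ext (hgA.trans hA.symm) (hgB.trans hB.symm)
  exact StarAlgHom.ext fun u => AlgHom.congr_fun h u

/-! ### Functoriality of the universal C⋆-completion -/

namespace MaxCStar

universe u

variable {P Q : Type u} [Ring P] [StarRing P] [Algebra ℂ P] [HasMaxCStarNorm P]
  [Ring Q] [StarRing Q] [Algebra ℂ Q] [HasMaxCStarNorm Q] [StarModule ℂ Q]

/-- The maximal seminorm dominates `‖π ·‖` by construction, so `π` is contractive and extends to the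
completion. -/
theorem uniformContinuous_hom {D : Type u} [CStarAlgebra D] (π : P →⋆ₐ[ℂ] D) :
    UniformContinuous (fun x : PreMaxCStar P => π x) := by
  let φ : PreMaxCStar P →+ D := { toFun := π, map_zero' := map_zero π, map_add' := map_add π }
  exact AddMonoidHomClass.uniformContinuous_of_bound φ 1 fun x => by
    rw [one_mul]; exact le_maxCStarNorm π x

/-- The extension to the completion of a `*`-homomorphism to a C⋆-algebra, as a function. -/
noncomputable def liftFun {D : Type u} [CStarAlgebra D] (π : P →⋆ₐ[ℂ] D) : MaxCStar P → D :=
  UniformSpace.Completion.extension (fun x : PreMaxCStar P => π x)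

theorem continuous_liftFun {D : Type u} [CStarAlgebra D] (π : P →⋆ₐ[ℂ] D) :
    Continuous (liftFun π) := UniformSpace.Completion.continuous_extension

theorem liftFun_of {D : Type u} [CStarAlgebra D] (π : P →⋆ₐ[ℂ] D) (x : P) :
    liftFun π (of P x) = π x :=
  UniformSpace.Completion.extension_coe (uniformContinuous_hom π) _

/-- The universal property of the universal C⋆-completion. -/
noncomputable def lift {D : Type u} [CStarAlgebra D] (π : P →⋆ₐ[ℂ] D) : MaxCStar P →⋆ₐ[ℂ] D where
  toFun := liftFun π
  map_one' := by rw [← map_one (of P), liftFun_of, map_one]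
  map_zero' := by rw [← map_zero (of P), liftFun_of, map_zero]
  map_mul' x y := denseRange_of.induction_on₂
    (p := fun x y : MaxCStar P => liftFun π (x * y) = liftFun π x * liftFun π y)
    (isClosed_eq ((continuous_liftFun π).comp (continuous_fst.mul continuous_snd))
      (((continuous_liftFun π).comp continuous_fst).mul
        ((continuous_liftFun π).comp continuous_snd)))
    (fun a b => by simp only [← map_mul, liftFun_of]) x y
  map_add' x y := denseRange_of.induction_on₂
    (p := fun x y : MaxCStar P => liftFun π (x + y) = liftFun π x + liftFun π y)
    (isClosed_eq ((continuous_liftFun π).comp (continuous_fst.add continuous_snd))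
      (((continuous_liftFun π).comp continuous_fst).add
        ((continuous_liftFun π).comp continuous_snd)))
    (fun a b => by simp only [← map_add, liftFun_of]) x y
  commutes' c := by rw [← AlgHomClass.commutes (of P), liftFun_of, AlgHomClass.commutes]
  map_star' x := denseRange_of.induction_on
    (p := fun x : MaxCStar P => liftFun π (star x) = star (liftFun π x)) x
    (isClosed_eq ((continuous_liftFun π).comp continuous_star')
      (continuous_star.comp (continuous_liftFun π)))
    fun a => by rw [← map_star, liftFun_of, liftFun_of, map_star]

theorem lift_of {D : Type u} [CStarAlgebra D] (π : P →⋆ₐ[ℂ] D) (x : P) :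
    lift π (of P x) = π x := liftFun_of π x

theorem continuous_lift {D : Type u} [CStarAlgebra D] (π : P →⋆ₐ[ℂ] D) :
    Continuous (lift π) := continuous_liftFun π

theorem hom_ext {D : Type u} [CStarAlgebra D] {f g : MaxCStar P → D} (hf : Continuous f)
    (hg : Continuous g) (h : ∀ x, f (of P x) = g (of P x)) : f = g :=
  denseRange_of.equalizer hf hg (funext h)

/-- Isomorphic `*`-algebras have isomorphic universal C⋆-completions. -/
noncomputable def congr [StarModule ℂ P] (e : P ≃⋆ₐ[ℂ] Q) : MaxCStar P ≃⋆ₐ[ℂ] MaxCStar Q :=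
  StarAlgEquiv.ofStarAlgHom (lift ((of Q).comp (e : P →⋆ₐ[ℂ] Q)))
    (lift ((of P).comp (e.symm : Q →⋆ₐ[ℂ] P)))
    (StarAlgHom.ext fun x => congrFun (hom_ext ((continuous_lift _).comp (continuous_lift _))
      continuous_id fun y => by simp [lift_of]) x)
    (StarAlgHom.ext fun x => congrFun (hom_ext ((continuous_lift _).comp (continuous_lift _))
      continuous_id fun y => by simp [lift_of]) x)

theorem congr_of [StarModule ℂ P] (e : P ≃⋆ₐ[ℂ] Q) (x : P) : congr e (of P x) = of Q (e x) :=
  lift_of _ x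

end MaxCStar

/-! ### Transport from the model to an arbitrary universal action. -/

theorem proposition6p3 :
    (∃ (G : CompactQuantumGroup)
      (a : IsometricAction (Multiplicative (ZMod 4))
        {Multiplicative.ofAdd 1, Multiplicative.ofAdd (-1)} G),
      a.IsQuantumIsometryGroup) ∧
    ∀ (G : CompactQuantumGroup)
      (a : IsometricAction (Multiplicative (ZMod 4))
        {Multiplicative.ofAdd 1, Multiplicative.ofAdd (-1)} G),
      a.IsQuantumIsometryGroup →
      ∃ A B : G.Pol,
        a.α (MonoidAlgebra.single (Multiplicative.ofAdd 1) 1) =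
          MonoidAlgebra.single (Multiplicative.ofAdd 1) 1 ⊗ₜ[ℂ] A +
            MonoidAlgebra.single (Multiplicative.ofAdd (-1)) 1 ⊗ₜ[ℂ] star B ∧
        a.α (MonoidAlgebra.single (Multiplicative.ofAdd (-1)) 1) =
          MonoidAlgebra.single (Multiplicative.ofAdd 1) 1 ⊗ₜ[ℂ] B +
            MonoidAlgebra.single (Multiplicative.ofAdd (-1)) 1 ⊗ₜ[ℂ] star A ∧
        ∃ Φ : G.C ≃⋆ₐ[ℂ] GroupCStar (DihedralGroup 0 × Multiplicative (ZMod 2)),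
          let z := GroupCStar.unit
            ((1, Multiplicative.ofAdd 1) : DihedralGroup 0 × Multiplicative (ZMod 2))
          let w := (1 / 2 : ℂ) • (1 + z) - (Complex.I / 2) • (1 - z)
          Φ (MaxCStar.of G.Pol (A ^ 2 + B ^ 2)) = z ∧
          Φ (MaxCStar.of G.Pol (A + B)) =
            w * GroupCStar.unit (DihedralGroup.sr 0, 1) ∧
          Φ (MaxCStar.of G.Pol (A - B)) =
            w * GroupCStar.unit (DihedralGroup.sr 1, 1) := by
  refine ⟨⟨_, _, isometryAction_isQuantumIsometryGroup⟩, fun G a ha => ?_⟩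
  obtain ⟨x, y, hpos, hneg⟩ := IsometricAction.exists_form a
  obtain ⟨e, he⟩ := ha.exists_equiv isometryAction_isQuantumIsometryGroup
  have n : (-1 : ZMod 4) ≠ 1 := by decide
  -- Both are the coefficient at `g` of the image of `g` under the respective action.
  have hx : e x = IsometryPol.A := by
    have h := he (Multiplicative.ofAdd 1) (cyclicFourBasis 1)
    rw [hpos, map_add, IsometricAction.tensorCoeff_same, IsometricAction.tensorCoeff_ne n,
      add_zero] at h
    refine h.trans ?_
    change tensorCoeff IsometryPol _ (IsometryPol.action _) = _
    rw [IsometryPol.action_pos, map_add, IsometricAction.tensorCoeff_same,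
      IsometricAction.tensorCoeff_ne n, add_zero]
  have hy : e y = IsometryPol.B := by
    have h := he (Multiplicative.ofAdd 1) (cyclicFourBasis (-1))
    rw [hneg, map_add, IsometricAction.tensorCoeff_same, IsometricAction.tensorCoeff_ne n,
      add_zero] at h
    refine h.trans ?_
    change tensorCoeff IsometryPol _ (IsometryPol.action _) = _
    rw [IsometryPol.action_neg, map_add, IsometricAction.tensorCoeff_same,
      IsometricAction.tensorCoeff_ne n, add_zero]
  let E : G.Pol ≃⋆ₐ[ℂ] MonoidAlgebra ℂ (DihedralGroup 0 × Multiplicative (ZMod 2)) :=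
    e.trans IsometryPol.equivGroupAlgebra
  -- Through `ψ` the identities for `A² + B²`, `A + B` and `A - B` in the model carry over verbatim,
  -- with `w` the image of `sqrtInvolution z`.
  let ψ : IsometryPol →⋆ₐ[ℂ] GroupCStar (DihedralGroup 0 × Multiplicative (ZMod 2)) :=
    (MaxCStar.of _).comp (IsometryPol.equivGroupAlgebra : IsometryPol →⋆ₐ[ℂ] _)
  have hΦ (p : G.Pol) : MaxCStar.congr E (MaxCStar.of G.Pol p) = ψ (e p) := MaxCStar.congr_of E p
  have hw : ψ (sqrtInvolution IsometryPol.z) = sqrtInvolution (ψ IsometryPol.z) :=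
    map_sqrtInvolution ψ.toAlgHom _
  refine ⟨x, y, hpos, hneg, MaxCStar.congr E, ?_, ?_, ?_⟩
  · rw [hΦ, map_add, map_pow, map_pow, hx, hy, sq, sq, IsometryPol.A_mul_A_add_B_mul_B]
    rfl
  · rw [hΦ, map_add, hx, hy, IsometryPol.A_add_B, map_mul, hw]
    rfl
  · rw [hΦ, map_sub, hx, hy, IsometryPol.A_sub_B, map_mul, hw]
    rfl
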